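/- For every $r>0$ there is a polynomial $p\in\mathbb R[k,s]$ such that the following holds for every $n$. Let $X$ be a random vector in $\mathbb R^n$ that is isotropic ($\mathbb E X=0$, $\mathbb E XX^{T}=I_n$) and $K$-subgaussian for some $K>0$, that is, $\Pr[|\langle X,x\rangle|\ge s]\le 2e^{-s^2/K^2}$ for all unit vectors $x$ and all $s>0$. Let $Z$ be a standard Gaussian vector in $\mathbb R^n$ independent of $X$, let $0<t\le 1$, and put $Y_t=\sqrt{1-t^2}\,X+tZ$. For a real random variable $W$ with Lebesgue density $f_W$ let $S(W)=\int_{\mathbb R} f_W(x)\log\frac{f_W(x)}{g(x)}\,dx$, where $g(x)=\frac1{\sqrt{2\pi}}e^{-x^2/2}$, and let $S(a)=S(\langle Y_t,a\rangle)$. Then for every $a\in\mathbb R^n\setminus\{0\}$ the variable $\langle Y_t,a\rangle$ has a Lebesgue density, the integral defining $S(a)$ converges absolutely, and $S$ is differentiable at $a$. Moreover the Euclidean gradient $\nabla S$ is Lipschitz on $\{a\in\mathbb R^n:\|a\|\ge r\}$ with constant at most $p(K,1/t)$. In particular (with $r=1$) $\nabla S$ is Lipschitz on the unit sphere with constant polynomial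 in $K$ and $1/t$, independent of $n$ and of the distribution of $X$. -/

import Mathlib

open MeasureTheory ProbabilityTheory
open scoped NNReal

/-- The Lebesgue density `f_W` of a real random variable `W` (meaningful when `HasPDF W P`). -/
noncomputable def density {Ω : Type*} [MeasurableSpace Ω] (P : Measure Ω) (W : Ω → ℝ) (x : ℝ) : ℝ :=
  (pdf W P volume x).toReal

/-- The integrand `f_W log (f_W / g)` of the relative entropy with respect to the standard
Gaussian, whose density is `g`. -/
noncomputable def relEntropyIntegrand {Ω : Type*} [MeasurableSpace Ω] (P : Measure Ω) (W : Ω → ℝ)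
    (x : ℝ) : ℝ :=
  density P W x * Real.log (density P W x / gaussianPDFReal 0 1 x)

/-- The relative entropy `S(W)` of `W` with respect to the standard Gaussian on `ℝ`. -/
noncomputable def relEntropy {Ω : Type*} [MeasurableSpace Ω] (P : Measure Ω) (W : Ω → ℝ) : ℝ :=
  ∫ x, relEntropyIntegrand P W x

/-- `X` is isotropic: `E X = 0` and `E X Xᵀ = I`. (All these moments are finite for measurable `X`
satisfying the second condition, since its diagonal entries are nonzero integrals.) -/
def IsIsotropic {Ω : Type*} [MeasurableSpace Ω] (P : Measure Ω) {n : ℕ}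
    (X : Ω → EuclideanSpace ℝ (Fin n)) : Prop :=
  (∀ i, ∫ ω, X ω i ∂P = 0) ∧
    (Matrix.of fun i j => ∫ ω, X ω i * X ω j ∂P) = (1 : Matrix (Fin n) (Fin n) ℝ)

/-- A real random variable `W` is `K`-subgaussian: `P[|W| ≥ s] ≤ 2 exp (-s² / K²)` for `s > 0`. -/
def IsSubgaussian {Ω : Type*} [MeasurableSpace Ω] (P : Measure Ω) (K : ℝ) (W : Ω → ℝ) : Prop :=
  ∀ s : ℝ, 0 < s → P.real {ω | s ≤ |W ω|} ≤ 2 * Real.exp (-s ^ 2 / K ^ 2)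

/-- A random vector is `K`-subgaussian if all its one-dimensional marginals are. -/
def IsSubgaussianVec {Ω : Type*} [MeasurableSpace Ω] (P : Measure Ω) (K : ℝ) {n : ℕ}
    (X : Ω → EuclideanSpace ℝ (Fin n)) : Prop :=
  ∀ x : EuclideanSpace ℝ (Fin n), ‖x‖ = 1 → IsSubgaussian P K (fun ω => inner ℝ (X ω) x)

/-- The smoothed vector `Y_t = √(1 - t²) X + t Z`. -/
noncomputable def smoothed {Ω : Type*} {n : ℕ} (X Z : Ω → EuclideanSpace ℝ (Fin n)) (t : ℝ) (ω : Ω) :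
    EuclideanSpace ℝ (Fin n) :=
  Real.sqrt (1 - t ^ 2) • X ω + t • Z ω

/-- The function `a ↦ S(⟨Y, a⟩)`. -/
noncomputable def marginalEntropy {Ω : Type*} [MeasurableSpace Ω] (P : Measure Ω) {n : ℕ}
    (Y : Ω → EuclideanSpace ℝ (Fin n)) (a : EuclideanSpace ℝ (Fin n)) : ℝ :=
  relEntropy P (fun ω => inner ℝ (Y ω) a)

/-! Write `c = √(1 - t²)`, `κ = c / t` and `σ = t‖a‖`. The marginal `⟨Y_t, a⟩` is `c⟨X, a⟩` plus an
independent `N(0, σ²)`, so after division by `σ` it becomes `⟨X, θ⟩ + N(0, 1)` with `θ = κ a / ‖a‖`.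
Since isotropy gives `E⟨Y_t, a⟩² = ‖a‖²`, the entropy splits (`marginalEntropy_smoothed`) as `S(a) =
H(θ) + log √(2π) - log (t‖a‖) + ‖a‖² / 2`, where `H(θ) = ∫ F log F` and `F` is the density of `⟨X,
θ⟩ + N(0, 1)`. The law of `X` enters only through `H`, and only on the ball of radius `κ ≤ 1 / t`.

It remains to bound two derivatives of `H` there. Under the integral sign they are built from `1 +
log F`, from averages `E[ψ(x - d) w]` with `d = ⟨X, θ⟩` and `ψ` a polynomial times the Gaussian
density, and from a quotient of two such averages by `F`. Sixth moments of marginals make the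
averages decay like `(1 + x²)⁻²` (`abs_smear_le`); a Jensen-type lower bound on `F` makes `log F`
grow at most like `1 + x²` (`Envelope.smoothDensity_ge`); Cauchy–Schwarz removes the division by `F`
(`Envelope.sq_smear_div_le`). Each integrand is then at most a constant times `(1 + x²)⁻¹`. Only
unit-direction marginals occur, so the constants do not see the dimension, and subgaussianity bounds
the sixth moments by `12 K⁶`.

Finally `SixthMomentLE.exists_gradient` turns line derivatives into a gradient of `H`, bounded and
Lipschitz on balls, and `boundedLipschitzOn_radialGradient` carries this through `a ↦ κ a / ‖a‖` on
`‖a‖ ≥ r`. -/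

/-! ### The standard Gaussian kernel and its derivatives -/

/-- The standard Gaussian density on `ℝ`. -/
noncomputable def stdPDF (u : ℝ) : ℝ := gaussianPDFReal 0 1 u

lemma stdPDF_eq (u : ℝ) : stdPDF u = (Real.sqrt (2 * Real.pi))⁻¹ * Real.exp (-(u ^ 2 / 2)) := by
  simp [stdPDF, gaussianPDFReal, neg_div]

lemma stdPDF_pos (u : ℝ) : 0 < stdPDF u := gaussianPDFReal_pos _ _ _ one_ne_zero

lemma one_le_sqrt_two_pi : 1 ≤ Real.sqrt (2 * Real.pi) := by
  rw [Real.one_le_sqrt]; linarith [Real.pi_gt_three]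

lemma log_sqrt_two_pi_le : Real.log (Real.sqrt (2 * Real.pi)) ≤ 1 := by
  rw [Real.log_le_iff_le_exp (by linarith [one_le_sqrt_two_pi]), Real.sqrt_le_left (by positivity)]
  have h := Real.exp_one_gt_d9
  nlinarith [Real.pi_lt_d2]

lemma stdPDF_le_exp (u : ℝ) : stdPDF u ≤ Real.exp (-(u ^ 2 / 2)) := by
  rw [stdPDF_eq]
  exact mul_le_of_le_one_left (Real.exp_nonneg _) (inv_le_one_of_one_le₀ one_le_sqrt_two_pi)

lemma stdPDF_le_one (u : ℝ) : stdPDF u ≤ 1 :=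
  (stdPDF_le_exp u).trans (Real.exp_le_one_iff.2 (by nlinarith [sq_nonneg u]))

lemma hasDerivAt_stdPDF (u : ℝ) : HasDerivAt stdPDF (-(u * stdPDF u)) u := by
  have h1 : HasDerivAt (fun u : ℝ => -(u ^ 2 / 2)) (-u) u := by
    exact (((hasDerivAt_pow 2 u).div_const 2).neg).congr_deriv (by simp)
  have h2 := (h1.exp).const_mul (Real.sqrt (2 * Real.pi))⁻¹
  rw [show stdPDF = _ from funext stdPDF_eq]
  exact h2.congr_deriv (by ring)

lemma hasDerivAt_mul_stdPDF (u : ℝ) :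
    HasDerivAt (fun u => u * stdPDF u) (-((u ^ 2 - 1) * stdPDF u)) u := by
  exact ((hasDerivAt_id u).mul (hasDerivAt_stdPDF u)).congr_deriv (by simp only [id]; ring)

lemma continuous_stdPDF : Continuous stdPDF :=
  continuous_iff_continuousAt.2 fun u => (hasDerivAt_stdPDF u).continuousAt

lemma pow_mul_stdPDF_le (u : ℝ) : (1 + u ^ 2) ^ 3 * stdPDF u ≤ 96 := by
  set z := (1 + u ^ 2) / 2 with hz
  have hz0 : 0 ≤ z := by positivity
  have h1 : z ^ 3 / 6 ≤ Real.exp z := by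
    simpa [Nat.factorial] using Real.pow_div_factorial_le_exp z hz0 3
  have h2 : stdPDF u ≤ 2 * Real.exp (-z) := by
    refine (stdPDF_le_exp u).trans ?_
    have : -(u ^ 2 / 2) = 1 / 2 + -z := by rw [hz]; ring
    rw [this, Real.exp_add]
    refine mul_le_mul_of_nonneg_right ?_ (Real.exp_nonneg _)
    have h3 : Real.exp (1 / 2) * Real.exp (1 / 2) = Real.exp 1 := by
      rw [← Real.exp_add]; norm_num
    nlinarith [Real.exp_one_lt_d9, Real.exp_pos (1 / 2 : ℝ)]
  have h4 : (1 + u ^ 2) ^ 3 = 8 * z ^ 3 := by rw [hz]; ring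
  rw [h4]
  calc 8 * z ^ 3 * stdPDF u ≤ 8 * z ^ 3 * (2 * Real.exp (-z)) := by gcongr
    _ ≤ 8 * (6 * Real.exp z) * (2 * Real.exp (-z)) := by
        gcongr
        linarith
    _ = 96 * (Real.exp z * Real.exp (-z)) := by ring
    _ = 96 := by rw [← Real.exp_add]; simp

lemma one_add_sq_add_le (u d : ℝ) : 1 + (u + d) ^ 2 ≤ 2 * (1 + u ^ 2) * (1 + d ^ 2) := by
  nlinarith [sq_nonneg (u - d), sq_nonneg (u * d)]

/-- Polynomial weight in `x` is traded for weight in `x - d`, absorbed by the Gaussian, and weight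
in `d`, paid for by moments. -/
lemma weighted_kernel_le (x d : ℝ) :
    (1 + x ^ 2) ^ 2 * ((1 + (x - d) ^ 2) * stdPDF (x - d)) ≤ 384 * (1 + d ^ 2) ^ 2 := by
  have h := one_add_sq_add_le (x - d) d
  rw [sub_add_cancel] at h
  have h2 : (1 + x ^ 2) ^ 2 ≤ (2 * (1 + (x - d) ^ 2) * (1 + d ^ 2)) ^ 2 := by gcongr
  have h0 := (stdPDF_pos (x - d)).le
  calc _ ≤ (2 * (1 + (x - d) ^ 2) * (1 + d ^ 2)) ^ 2 * ((1 + (x - d) ^ 2) * stdPDF (x - d)) := by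
        gcongr
    _ = 4 * (1 + d ^ 2) ^ 2 * ((1 + (x - d) ^ 2) ^ 3 * stdPDF (x - d)) := by ring
    _ ≤ 4 * (1 + d ^ 2) ^ 2 * 96 := by gcongr; exact pow_mul_stdPDF_le _
    _ = _ := by ring

/-- A continuous kernel dominated by `(1 + u²) φ(u)`. -/
structure GaussDominated (ψ : ℝ → ℝ) : Prop where
  continuous : Continuous ψ
  abs_le : ∀ u, |ψ u| ≤ (1 + u ^ 2) * stdPDF u

lemma GaussDominated.bdd {ψ : ℝ → ℝ} (h : GaussDominated ψ) (u : ℝ) : |ψ u| ≤ 96 := by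
  refine (h.abs_le u).trans ((mul_le_mul_of_nonneg_right ?_ (stdPDF_pos u).le).trans
    (pow_mul_stdPDF_le u))
  exact le_self_pow₀ (by nlinarith [sq_nonneg u]) (by norm_num)

lemma gaussDominated_stdPDF : GaussDominated stdPDF :=
  ⟨continuous_stdPDF, fun u => by
    rw [abs_of_pos (stdPDF_pos u)]
    nlinarith [stdPDF_pos u, mul_nonneg (sq_nonneg u) (stdPDF_pos u).le]⟩

lemma gaussDominated_mul_stdPDF : GaussDominated (fun u => u * stdPDF u) :=
  ⟨continuous_id.mul continuous_stdPDF, fun u => by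
    rw [abs_mul, abs_of_pos (stdPDF_pos u)]
    refine mul_le_mul_of_nonneg_right ?_ (stdPDF_pos u).le
    rw [← sq_abs]; nlinarith [sq_nonneg (|u| - 1)]⟩

lemma gaussDominated_sq_mul_stdPDF : GaussDominated (fun u => u ^ 2 * stdPDF u) :=
  ⟨(continuous_pow 2).mul continuous_stdPDF, fun u => by
    rw [abs_mul, abs_of_pos (stdPDF_pos u), abs_of_nonneg (sq_nonneg u)]
    exact mul_le_mul_of_nonneg_right (by linarith) (stdPDF_pos u).le⟩

lemma gaussDominated_sq_sub_one_mul_stdPDF : GaussDominated (fun u => (u ^ 2 - 1) * stdPDF u) :=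
  ⟨((continuous_pow 2).sub continuous_const).mul continuous_stdPDF, fun u => by
    rw [abs_mul, abs_of_pos (stdPDF_pos u)]
    refine mul_le_mul_of_nonneg_right ?_ (stdPDF_pos u).le
    rw [abs_le]; constructor <;> nlinarith [sq_nonneg u]⟩

/-! ### Weighted smoothing of a random variable -/

section Smear

variable {Ω : Type*} [MeasurableSpace Ω]

/-- `E[ψ(x - d) w]` as a function of `x`. -/
noncomputable def smear (P : Measure Ω) (ψ : ℝ → ℝ) (w d : Ω → ℝ) (x : ℝ) : ℝ :=
  ∫ ω, ψ (x - d ω) * w ω ∂P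

/-- The density of `d + N(0,1)`. -/
noncomputable def smoothDensity (P : Measure Ω) (d : Ω → ℝ) (x : ℝ) : ℝ :=
  smear P stdPDF (fun _ => 1) d x

variable {P : Measure Ω} {ψ χ : ℝ → ℝ} {w d : Ω → ℝ}

lemma integrable_smear (hψ : GaussDominated ψ) (hd : AEStronglyMeasurable d P)
    (hw : Integrable w P) (x : ℝ) : Integrable (fun ω => ψ (x - d ω) * w ω) P :=
  hw.bdd_mul (c := 96) (hψ.continuous.comp_aestronglyMeasurable (aestronglyMeasurable_const.sub hd))
    (Filter.Eventually.of_forall fun _ => hψ.bdd _)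

lemma continuous_smear (hψ : GaussDominated ψ) (hd : AEStronglyMeasurable d P)
    (hw : Integrable w P) : Continuous (smear P ψ w d) := by
  refine continuous_of_dominated (bound := fun ω => 96 * |w ω|)
    (fun x => (integrable_smear hψ hd hw x).1) (fun x => ?_) (hw.abs.const_mul 96) ?_
  · filter_upwards with ω
    rw [norm_mul]
    exact mul_le_mul_of_nonneg_right (hψ.bdd _) (abs_nonneg _)
  · filter_upwards with ω
    exact (hψ.continuous.comp (continuous_id.sub continuous_const)).mul continuous_const

/-- By `weighted_kernel_le` the weight `(1 + x²)²` costs `384 (1 + d²)² ≤ 1536 T²`, and `|w| ≤ T`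
supplies the third power of `T`. -/
lemma abs_smear_le {T : Ω → ℝ} (hψ : GaussDominated ψ) (hd : AEStronglyMeasurable d P)
    (hw : Integrable w P) (hT : Integrable (fun ω => T ω ^ 3) P) (hT1 : ∀ ω, 1 ≤ T ω)
    (hdT : ∀ ω, 1 + d ω ^ 2 ≤ 2 * T ω) (hwT : ∀ ω, |w ω| ≤ T ω) (x : ℝ) :
    |smear P ψ w d x| ≤ 1536 * (∫ ω, T ω ^ 3 ∂P) * ((1 + x ^ 2)⁻¹) ^ 2 := by
  have hx : (0:ℝ) < (1 + x ^ 2) ^ 2 := by positivity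
  rw [inv_pow, ← div_eq_mul_inv, le_div_iff₀ hx, ← integral_const_mul]
  calc |smear P ψ w d x| * (1 + x ^ 2) ^ 2
      ≤ (∫ ω, |ψ (x - d ω) * w ω| ∂P) * (1 + x ^ 2) ^ 2 := by
        gcongr
        exact abs_integral_le_integral_abs
    _ = ∫ ω, |ψ (x - d ω) * w ω| * (1 + x ^ 2) ^ 2 ∂P := (integral_mul_const _ _).symm
    _ ≤ _ := by
        refine integral_mono ((integrable_smear hψ hd hw x).abs.mul_const _) (hT.const_mul _) ?_
        intro ω
        have hT0 : 0 ≤ T ω := zero_le_one.trans (hT1 ω)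
        have h1 := weighted_kernel_le x (d ω)
        have h2 : (1 + d ω ^ 2) ^ 2 ≤ (2 * T ω) ^ 2 := by
          gcongr
          exact hdT ω
        simp only [abs_mul]
        calc |ψ (x - d ω)| * |w ω| * (1 + x ^ 2) ^ 2
            ≤ ((1 + (x - d ω) ^ 2) * stdPDF (x - d ω)) * T ω * (1 + x ^ 2) ^ 2 := by
              have := (stdPDF_pos (x - d ω)).le
              gcongr
              · exact hψ.abs_le _
              · exact hwT ω
          _ = ((1 + x ^ 2) ^ 2 * ((1 + (x - d ω) ^ 2) * stdPDF (x - d ω))) * T ω := by ring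
          _ ≤ (384 * (2 * T ω) ^ 2) * T ω := by
              exact mul_le_mul_of_nonneg_right (h1.trans (by gcongr)) hT0
          _ = 1536 * T ω ^ 3 := by ring

/-- The kernel derivative is taken as `-χ` so that its sign cancels the one from `x - d`.
Boundedness of `χ` gives a dominating function independent of `s`. -/
lemma hasDerivAt_smear {p q : Ω → ℝ} (hψ : GaussDominated ψ) (hχ : GaussDominated χ)
    (hderiv : ∀ u, HasDerivAt ψ (-χ u) u) (hp : AEStronglyMeasurable p P)
    (hq : AEStronglyMeasurable q P) (hw : Integrable w P)
    (hqw : Integrable (fun ω => q ω * w ω) P) (x s : ℝ) :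
    HasDerivAt (fun s => smear P ψ w (fun ω => p ω + s * q ω) x)
      (smear P χ (fun ω => q ω * w ω) (fun ω => p ω + s * q ω) x) s := by
  have hd : ∀ s : ℝ, AEStronglyMeasurable (fun ω => p ω + s * q ω) P :=
    fun s => hp.add (hq.const_mul s)
  refine (hasDerivAt_integral_of_dominated_loc_of_deriv_le (s := Set.univ)
    (bound := fun ω => 96 * |q ω * w ω|)
    (F' := fun s ω => χ (x - (p ω + s * q ω)) * (q ω * w ω)) Filter.univ_mem
    (Filter.Eventually.of_forall fun s => (integrable_smear hψ (hd s) hw x).1)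
    (integrable_smear hψ (hd s) hw x) (integrable_smear hχ (hd s) hqw x).1
    (Filter.Eventually.of_forall fun ω s _ => ?_) (hqw.abs.const_mul _)
    (Filter.Eventually.of_forall fun ω s _ => ?_)).2
  · rw [norm_mul]
    exact mul_le_mul_of_nonneg_right (hχ.bdd _) (abs_nonneg _)
  · have h1 : HasDerivAt (fun s : ℝ => x - (p ω + s * q ω)) (-q ω) s := by
      simpa using (((hasDerivAt_id s).mul_const (q ω)).const_add (p ω)).const_sub x
    exact (((hderiv _).comp s h1).mul_const (w ω)).congr_deriv (by ring)

end Smear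

/-! ### First and second derivatives of the entropy along a line of shifts. -/

section Entropy

variable {Ω : Type*} [MeasurableSpace Ω] {P : Measure Ω}

/-- `T` dominates `d` quadratically and has a third moment. -/
structure Envelope (P : Measure Ω) (d T : Ω → ℝ) : Prop where
  meas : AEStronglyMeasurable d P
  integrable : Integrable (fun ω => T ω ^ 3) P
  one_le : ∀ ω, 1 ≤ T ω
  sq_le : ∀ ω, 1 + d ω ^ 2 ≤ 2 * T ω

variable {p q v w d T : Ω → ℝ} {ψ : ℝ → ℝ}

lemma Envelope.le_cube (h : Envelope P d T) (ω : Ω) : T ω ≤ T ω ^ 3 :=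
  le_self_pow₀ (h.one_le ω) (by norm_num)

lemma Envelope.integrable_of_abs_le (h : Envelope P d T) (hw : AEStronglyMeasurable w P)
    (hwT : ∀ ω, |w ω| ≤ T ω) : Integrable w P :=
  h.integrable.mono' hw (Filter.Eventually.of_forall fun ω => (hwT ω).trans (h.le_cube ω))

lemma Envelope.abs_smear_le (h : Envelope P d T) (hψ : GaussDominated ψ)
    (hw : AEStronglyMeasurable w P) (hwT : ∀ ω, |w ω| ≤ T ω) (x : ℝ) :
    |smear P ψ w d x| ≤ 1536 * (∫ ω, T ω ^ 3 ∂P) * ((1 + x ^ 2)⁻¹) ^ 2 :=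
  _root_.abs_smear_le hψ h.meas (h.integrable_of_abs_le hw hwT) h.integrable h.one_le h.sq_le hwT x

lemma Envelope.continuous_smear (h : Envelope P d T) (hψ : GaussDominated ψ)
    (hw : AEStronglyMeasurable w P) (hwT : ∀ ω, |w ω| ≤ T ω) : Continuous (smear P ψ w d) :=
  _root_.continuous_smear hψ h.meas (h.integrable_of_abs_le hw hwT)

lemma Envelope.continuous_smoothDensity (h : Envelope P d T) : Continuous (smoothDensity P d) :=
  h.continuous_smear gaussDominated_stdPDF aestronglyMeasurable_const
    fun ω => by simpa using h.one_le ω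

/-- `∫ F log F` for the density `F` of `d + N(0,1)`. -/
noncomputable def negEntropy (P : Measure Ω) (d : Ω → ℝ) : ℝ :=
  ∫ x, smoothDensity P d x * Real.log (smoothDensity P d x)

/-- The derivative of `negEntropy` at `d` in the direction `v`. -/
noncomputable def entropyGrad (P : Measure Ω) (v d : Ω → ℝ) : ℝ :=
  ∫ x, (1 + Real.log (smoothDensity P d x)) * smear P (fun u => u * stdPDF u) v d x

lemma entropyGrad_const_mul (c : ℝ) : entropyGrad P (fun ω => c * v ω) d
    = c * entropyGrad P v d := by
  have h : ∀ x, smear P (fun u => u * stdPDF u) (fun ω => c * v ω) d x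
      = c * smear P (fun u => u * stdPDF u) v d x := fun x => by
    rw [smear, smear, ← integral_const_mul]
    simp only [mul_left_comm]
  simp only [entropyGrad, h]
  rw [← integral_const_mul]
  simp only [mul_left_comm]

/-- One envelope serves all `|s| ≤ 1`, so the resulting bounds are uniform in `s` and can dominate
derivatives in `s`. -/
lemma envelope_line (hp : AEStronglyMeasurable p P) (hq : AEStronglyMeasurable q P)
    (hT : Integrable (fun ω => (1 + p ω ^ 2 + q ω ^ 2 + v ω ^ 2) ^ 3) P) {s : ℝ} (hs : |s| ≤ 1) :
    Envelope P (fun ω => p ω + s * q ω) (fun ω => 1 + p ω ^ 2 + q ω ^ 2 + v ω ^ 2) where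
  meas := hp.add (hq.const_mul s)
  integrable := hT
  one_le ω := by nlinarith [sq_nonneg (p ω), sq_nonneg (q ω), sq_nonneg (v ω)]
  sq_le ω := by
    have h1 : s ^ 2 ≤ 1 := by rw [← sq_abs]; exact pow_le_one₀ (abs_nonneg s) hs
    nlinarith [sq_nonneg (p ω - s * q ω), mul_le_mul_of_nonneg_right h1 (sq_nonneg (q ω)),
      sq_nonneg (v ω)]

variable [IsProbabilityMeasure P]

lemma Envelope.one_le_integral (h : Envelope P d T) : 1 ≤ ∫ ω, T ω ^ 3 ∂P := by
  have := integral_mono (μ := P) (integrable_const (1 : ℝ)) h.integrable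
    (fun ω => (h.one_le ω).trans (h.le_cube ω))
  simpa using this

/-- Jensen's inequality for `exp`, in tangent-line form, after `(x - d)² / 2 ≤ x² + d²` and `d² ≤
2T³`. -/
lemma Envelope.smoothDensity_ge (h : Envelope P d T) (x : ℝ) :
    (Real.sqrt (2 * Real.pi))⁻¹ * Real.exp (-(x ^ 2 + 2 * ∫ ω, T ω ^ 3 ∂P))
      ≤ smoothDensity P d x := by
  set M := ∫ ω, T ω ^ 3 ∂P with hM
  set c := (Real.sqrt (2 * Real.pi))⁻¹ with hc
  have hc0 : 0 ≤ c := by positivity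
  -- The tangent line to `exp` at `0`, evaluated at `2M - 2T³`, has mean `1` because `M = E T³`.
  have key : ∫ ω, c * Real.exp (-(x ^ 2 + 2 * M)) * ((1 + 2 * M) - 2 * T ω ^ 3) ∂P
      = c * Real.exp (-(x ^ 2 + 2 * M)) := by
    rw [integral_const_mul, integral_sub (integrable_const _) (h.integrable.const_mul 2),
      integral_const_mul, ← hM]
    simp
  rw [← key]
  refine integral_mono (((integrable_const _).sub (h.integrable.const_mul 2)).const_mul _)
    (integrable_smear gaussDominated_stdPDF h.meas (integrable_const _) x) fun ω => ?_
  simp only [mul_one]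
  rw [stdPDF_eq, mul_assoc]
  refine mul_le_mul_of_nonneg_left ?_ hc0
  have h1 : (x - d ω) ^ 2 / 2 ≤ x ^ 2 + 2 * T ω ^ 3 := by
    nlinarith [h.sq_le ω, h.le_cube ω, sq_nonneg (x + d ω)]
  calc Real.exp (-(x ^ 2 + 2 * M)) * ((1 + 2 * M) - 2 * T ω ^ 3)
      ≤ Real.exp (-(x ^ 2 + 2 * M)) * Real.exp (2 * M - 2 * T ω ^ 3) := by
        gcongr
        linarith [Real.add_one_le_exp (2 * M - 2 * T ω ^ 3)]
    _ ≤ Real.exp (-((x - d ω) ^ 2 / 2)) := by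
        rw [← Real.exp_add, Real.exp_le_exp]
        linarith

lemma Envelope.smoothDensity_pos (h : Envelope P d T) (x : ℝ) : 0 < smoothDensity P d x :=
  lt_of_lt_of_le (mul_pos (by positivity) (Real.exp_pos _)) (h.smoothDensity_ge x)

lemma Envelope.smoothDensity_le_one (h : Envelope P d T) (x : ℝ) : smoothDensity P d x ≤ 1 := by
  have := integral_mono (μ := P)
    (integrable_smear gaussDominated_stdPDF h.meas (integrable_const (1 : ℝ)) x)
    (integrable_const (1 : ℝ)) (fun ω => by simpa using stdPDF_le_one (x - d ω))
  simpa [smoothDensity, smear] using this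

lemma Envelope.log_smoothDensity_ge (h : Envelope P d T) (x : ℝ) :
    -(x ^ 2 + 2 * (∫ ω, T ω ^ 3 ∂P) + 1) ≤ Real.log (smoothDensity P d x) := by
  have h1 := Real.log_le_log (mul_pos (by positivity) (Real.exp_pos _)) (h.smoothDensity_ge x)
  rw [Real.log_mul (by positivity) (Real.exp_pos _).ne', Real.log_exp, Real.log_inv] at h1
  linarith [log_sqrt_two_pi_le]

/-- `F ≤ 1` fixes the sign of the logarithm, and `1 ≤ ∫ T³` absorbs the additive constants. -/
lemma Envelope.abs_log_smoothDensity_le (h : Envelope P d T) (x : ℝ) :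
    |Real.log (smoothDensity P d x)| ≤ 4 * (∫ ω, T ω ^ 3 ∂P) * (1 + x ^ 2) := by
  have h1 := h.log_smoothDensity_ge x
  have h2 := Real.log_nonpos (h.smoothDensity_pos x).le (h.smoothDensity_le_one x)
  have h3 := h.one_le_integral
  have h4 := mul_nonneg (sub_nonneg.2 h3) (sq_nonneg x)
  rw [abs_le]
  constructor <;> nlinarith [sq_nonneg x]

lemma Envelope.abs_one_add_log_smoothDensity_le (h : Envelope P d T) (x : ℝ) :
    |1 + Real.log (smoothDensity P d x)| ≤ 4 * (∫ ω, T ω ^ 3 ∂P) * (1 + x ^ 2) := by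
  have h1 := h.log_smoothDensity_ge x
  have h2 := Real.log_nonpos (h.smoothDensity_pos x).le (h.smoothDensity_le_one x)
  have h3 := h.one_le_integral
  have h4 := mul_nonneg (sub_nonneg.2 h3) (sq_nonneg x)
  rw [abs_le]
  constructor <;> nlinarith [sq_nonneg x]

lemma Envelope.continuous_log_smoothDensity (h : Envelope P d T) :
    Continuous (fun x => Real.log (smoothDensity P d x)) :=
  h.continuous_smoothDensity.log fun x => (h.smoothDensity_pos x).ne'

lemma Envelope.abs_mul_smear_le (h : Envelope P d T) (hψ : GaussDominated ψ)
    (hw : AEStronglyMeasurable w P) (hwT : ∀ ω, |w ω| ≤ T ω) {x y : ℝ}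
    (hy : |y| ≤ 4 * (∫ ω, T ω ^ 3 ∂P) * (1 + x ^ 2)) :
    |y * smear P ψ w d x| ≤ 6144 * (∫ ω, T ω ^ 3 ∂P) ^ 2 * (1 + x ^ 2)⁻¹ := by
  have h3 := h.one_le_integral
  have hx : 0 < 1 + x ^ 2 := by positivity
  rw [abs_mul]
  calc |y| * |smear P ψ w d x| ≤ (4 * (∫ ω, T ω ^ 3 ∂P) * (1 + x ^ 2)) *
        (1536 * (∫ ω, T ω ^ 3 ∂P) * ((1 + x ^ 2)⁻¹) ^ 2) := by
        gcongr
        exact h.abs_smear_le hψ hw hwT x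
    _ = _ := by field_simp; ring

/-- Cauchy–Schwarz for the weight `stdPDF (x - d)`, whose total mass is `F(x)`. It spares any lower
bound on `F`, which may decay like a Gaussian. -/
lemma Envelope.sq_smear_div_le (h : Envelope P d T) (hw : AEStronglyMeasurable w P)
    (hwT : ∀ ω, w ω ^ 2 ≤ T ω) (x : ℝ) :
    smear P (fun u => u * stdPDF u) w d x ^ 2 / smoothDensity P d x
      ≤ smear P (fun u => u ^ 2 * stdPDF u) (fun ω => w ω ^ 2) d x := by
  have hF := h.smoothDensity_pos x
  have hw2 : Integrable (fun ω => w ω ^ 2) P :=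
    h.integrable_of_abs_le (hw.pow 2) fun ω => by rw [abs_of_nonneg (sq_nonneg _)]; exact hwT ω
  have hw1 : Integrable w P := by
    refine h.integrable_of_abs_le hw fun ω => ?_
    refine abs_le_of_sq_le_sq ((hwT ω).trans ?_) (zero_le_one.trans (h.one_le ω))
    exact le_self_pow₀ (h.one_le ω) (by norm_num)
  set A := smear P (fun u => u * stdPDF u) w d x with hA
  set F := smoothDensity P d x with hFdef
  have i1 := integrable_smear gaussDominated_mul_stdPDF h.meas hw1 x
  have i2 := integrable_smear gaussDominated_sq_mul_stdPDF h.meas hw2 x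
  have i0 := integrable_smear gaussDominated_stdPDF h.meas (integrable_const (1 : ℝ)) x
  -- This is the mean of `((x - d) w - A / F)²` under that weight; `A / F` is the minimizing
  -- constant.
  have key : 0 ≤ ∫ ω, ((x - d ω) ^ 2 * stdPDF (x - d ω) * w ω ^ 2
      - 2 * (A / F) * ((x - d ω) * stdPDF (x - d ω) * w ω)
      + (A / F) ^ 2 * (stdPDF (x - d ω) * 1)) ∂P := by
    refine integral_nonneg fun ω => ?_
    have : 0 ≤ stdPDF (x - d ω) * ((x - d ω) * w ω - A / F) ^ 2 :=
      mul_nonneg (stdPDF_pos _).le (sq_nonneg _)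
    simp only [Pi.zero_apply]
    linarith
  have i12 : Integrable (fun ω => (x - d ω) ^ 2 * stdPDF (x - d ω) * w ω ^ 2
      - 2 * (A / F) * ((x - d ω) * stdPDF (x - d ω) * w ω)) P := i2.sub (i1.const_mul _)
  rw [integral_add i12 (i0.const_mul _), integral_sub i2 (i1.const_mul _),
    integral_const_mul, integral_const_mul] at key
  change 0 ≤ smear P (fun u => u ^ 2 * stdPDF u) (fun ω => w ω ^ 2) d x - 2 * (A / F) * A
    + (A / F) ^ 2 * F at key
  have : 2 * (A / F) * A - (A / F) ^ 2 * F = A ^ 2 / F := by field_simp; ring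
  linarith

lemma Envelope.abs_smear_mul_smear_div_le (h : Envelope P d T) (hv : AEStronglyMeasurable v P)
    (hw : AEStronglyMeasurable w P) (hvT : ∀ ω, v ω ^ 2 ≤ T ω) (hwT : ∀ ω, w ω ^ 2 ≤ T ω) (x : ℝ) :
    |smear P (fun u => u * stdPDF u) w d x / smoothDensity P d x
        * smear P (fun u => u * stdPDF u) v d x|
      ≤ 1536 * (∫ ω, T ω ^ 3 ∂P) ^ 2 * (1 + x ^ 2)⁻¹ := by
  have hF := h.smoothDensity_pos x
  have h3 := h.one_le_integral
  have aux : ∀ {w : Ω → ℝ}, AEStronglyMeasurable w P → (∀ ω, w ω ^ 2 ≤ T ω) →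
      smear P (fun u => u * stdPDF u) w d x ^ 2 / smoothDensity P d x
      ≤ 1536 * (∫ ω, T ω ^ 3 ∂P) ^ 2 * (1 + x ^ 2)⁻¹ := by
    intro w hw hwT
    refine (h.sq_smear_div_le hw hwT x).trans ((le_abs_self _).trans
      ((h.abs_smear_le gaussDominated_sq_mul_stdPDF (hw.pow 2)
        (fun ω => by rw [abs_of_nonneg (sq_nonneg _)]; exact hwT ω) x).trans ?_))
    gcongr
    · exact le_self_pow₀ h3 (by norm_num)
    · exact pow_le_of_le_one (by positivity) (inv_le_one_of_one_le₀ (by nlinarith [sq_nonneg x]))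
        (by norm_num)
  have h1 := aux hv hvT
  have h2 := aux hw hwT
  set a := smear P (fun u => u * stdPDF u) w d x
  set b := smear P (fun u => u * stdPDF u) v d x
  set F := smoothDensity P d x
  have e1 : a / F * b - (-(a ^ 2 / F + b ^ 2 / F) / 2) = (a + b) ^ 2 / F / 2 := by
    field_simp; ring
  have e2 : (a ^ 2 / F + b ^ 2 / F) / 2 - a / F * b = (a - b) ^ 2 / F / 2 := by
    field_simp; ring
  have p1 : 0 ≤ (a + b) ^ 2 / F / 2 := by positivity
  have p2 : 0 ≤ (a - b) ^ 2 / F / 2 := by positivity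
  rw [abs_le]
  constructor <;> linarith

lemma Envelope.integrable_negEntropy (h : Envelope P d T) :
    Integrable fun x => smoothDensity P d x * Real.log (smoothDensity P d x) := by
  refine (integrable_inv_one_add_sq.const_mul (6144 * (∫ ω, T ω ^ 3 ∂P) ^ 2)).mono'
    (h.continuous_smoothDensity.mul h.continuous_log_smoothDensity).aestronglyMeasurable
    (Filter.Eventually.of_forall fun x => ?_)
  rw [mul_comm]
  exact h.abs_mul_smear_le gaussDominated_stdPDF aestronglyMeasurable_const
    (fun ω => by simpa using h.one_le ω) (h.abs_log_smoothDensity_le x)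

lemma Envelope.integrable_entropyGrad (h : Envelope P d T) (hψ : GaussDominated ψ)
    (hv : AEStronglyMeasurable v P) (hvT : ∀ ω, |v ω| ≤ T ω) :
    Integrable fun x => (1 + Real.log (smoothDensity P d x)) * smear P ψ v d x :=
  (integrable_inv_one_add_sq.const_mul (6144 * (∫ ω, T ω ^ 3 ∂P) ^ 2)).mono'
    ((continuous_const.add h.continuous_log_smoothDensity).mul
      (h.continuous_smear hψ hv hvT)).aestronglyMeasurable
    (Filter.Eventually.of_forall fun x => h.abs_mul_smear_le hψ hv hvT
      (h.abs_one_add_log_smoothDensity_le x))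

lemma abs_integral_le_of_le_inv_one_add_sq {f : ℝ → ℝ} {C : ℝ} (hC : 0 ≤ C)
    (hf : ∀ x, |f x| ≤ C * (1 + x ^ 2)⁻¹) : |∫ x, f x| ≤ 4 * C := by
  have h := norm_integral_le_of_norm_le (f := f) (integrable_inv_one_add_sq.const_mul C)
    (Filter.Eventually.of_forall fun x => by simpa using hf x)
  rw [integral_const_mul, integral_univ_inv_one_add_sq] at h
  refine h.trans ?_
  nlinarith [Real.pi_lt_four]

lemma Envelope.abs_entropyGrad_le (h : Envelope P d T)
    (hv : AEStronglyMeasurable v P) (hvT : ∀ ω, |v ω| ≤ T ω) :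
    |entropyGrad P v d| ≤ 24576 * (∫ ω, T ω ^ 3 ∂P) ^ 2 := by
  refine (abs_integral_le_of_le_inv_one_add_sq (by positivity) fun x =>
    h.abs_mul_smear_le gaussDominated_mul_stdPDF hv hvT
      (h.abs_one_add_log_smoothDensity_le x)).trans (le_of_eq (by ring))

/-- Differentiation under the integral, from `(F log F)' = (1 + log F) F'`. The envelope is that of
`envelope_line` with `v = q`. -/
theorem hasDerivAt_negEntropy (hp : AEStronglyMeasurable p P) (hq : AEStronglyMeasurable q P)
    (hT : Integrable (fun ω => (1 + p ω ^ 2 + q ω ^ 2 + q ω ^ 2) ^ 3) P) :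
    HasDerivAt (fun s : ℝ => negEntropy P (fun ω => p ω + s * q ω)) (entropyGrad P q p) 0 := by
  have henv := fun {s : ℝ} (hs : |s| ≤ 1) => envelope_line (s := s) hp hq hT hs
  set M := ∫ ω, (1 + p ω ^ 2 + q ω ^ 2 + q ω ^ 2) ^ 3 ∂P with hM
  have hqT : ∀ ω, |q ω| ≤ 1 + p ω ^ 2 + q ω ^ 2 + q ω ^ 2 := fun ω => by
    rw [← sq_abs (q ω)]; nlinarith [sq_nonneg (p ω), sq_nonneg (|q ω| - 1)]
  have h0 : |(0:ℝ)| ≤ 1 := by simp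
  have hq1 : Integrable q P := (henv h0).integrable_of_abs_le hq hqT
  have hball : ∀ s ∈ Metric.ball (0:ℝ) 1, |s| ≤ 1 := fun s hs => by
    simpa using (Metric.mem_ball.1 hs).le
  have key := (hasDerivAt_integral_of_dominated_loc_of_deriv_le (μ := volume) (x₀ := (0:ℝ))
    (F := fun s x => smoothDensity P (fun ω => p ω + s * q ω) x
      * Real.log (smoothDensity P (fun ω => p ω + s * q ω) x))
    (F' := fun s x => (1 + Real.log (smoothDensity P (fun ω => p ω + s * q ω) x))
      * smear P (fun u => u * stdPDF u) q (fun ω => p ω + s * q ω) x)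
    (bound := fun x => 6144 * M ^ 2 * (1 + x ^ 2)⁻¹)
    (Metric.ball_mem_nhds 0 one_pos)
    (Filter.eventually_of_mem (Metric.ball_mem_nhds 0 one_pos)
      fun s hs => (henv (hball s hs)).integrable_negEntropy.1)
    (henv h0).integrable_negEntropy
    ((henv h0).integrable_entropyGrad gaussDominated_mul_stdPDF hq hqT).1
    (Filter.Eventually.of_forall fun x s hs =>
      (henv (hball s hs)).abs_mul_smear_le gaussDominated_mul_stdPDF hq hqT
        ((henv (hball s hs)).abs_one_add_log_smoothDensity_le x))
    (integrable_inv_one_add_sq.const_mul _)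
    (Filter.Eventually.of_forall fun x s hs => ?_)).2
  · simpa [entropyGrad, negEntropy] using key
  · have h1 := hasDerivAt_smear gaussDominated_stdPDF gaussDominated_mul_stdPDF hasDerivAt_stdPDF
      hp hq (integrable_const (1:ℝ)) (by simpa using hq1) x s
    simp only [mul_one] at h1
    have hpos := (henv (hball s hs)).smoothDensity_pos x
    change HasDerivAt (fun s => smoothDensity P (fun ω => p ω + s * q ω) x) _ s at h1
    refine (h1.mul (h1.log hpos.ne')).congr_deriv ?_
    field_simp
    ring

/-- Differentiating `(1 + log F) · E[u φ(u) v]` gives a quotient term, controlled by Cauchy–Schwarz,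
and a logarithmic term with kernel `(u² - 1) φ(u)`. -/
theorem exists_hasDerivAt_entropyGrad (hp : AEStronglyMeasurable p P)
    (hq : AEStronglyMeasurable q P) (hv : AEStronglyMeasurable v P)
    (hT : Integrable (fun ω => (1 + p ω ^ 2 + q ω ^ 2 + v ω ^ 2) ^ 3) P) :
    ∃ g, HasDerivAt (fun s : ℝ => entropyGrad P v (fun ω => p ω + s * q ω)) g 0 ∧
      |g| ≤ 30720 * (∫ ω, (1 + p ω ^ 2 + q ω ^ 2 + v ω ^ 2) ^ 3 ∂P) ^ 2 := by
  have henv := fun {s : ℝ} (hs : |s| ≤ 1) => envelope_line (s := s) hp hq hT hs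
  set M := ∫ ω, (1 + p ω ^ 2 + q ω ^ 2 + v ω ^ 2) ^ 3 ∂P with hM
  have hvT : ∀ ω, |v ω| ≤ 1 + p ω ^ 2 + q ω ^ 2 + v ω ^ 2 := fun ω => by
    rw [← sq_abs (v ω)]; nlinarith [sq_nonneg (p ω), sq_nonneg (q ω), sq_nonneg (|v ω| - 1)]
  have hqT : ∀ ω, |q ω| ≤ 1 + p ω ^ 2 + q ω ^ 2 + v ω ^ 2 := fun ω => by
    rw [← sq_abs (q ω)]; nlinarith [sq_nonneg (p ω), sq_nonneg (v ω), sq_nonneg (|q ω| - 1)]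
  have hqvT : ∀ ω, |q ω * v ω| ≤ 1 + p ω ^ 2 + q ω ^ 2 + v ω ^ 2 := fun ω => by
    rw [abs_mul, ← sq_abs (q ω), ← sq_abs (v ω)]
    nlinarith [sq_nonneg (p ω), sq_nonneg (|q ω| - |v ω|), sq_nonneg (|q ω|), sq_nonneg (|v ω|)]
  have hv2 : ∀ ω, v ω ^ 2 ≤ 1 + p ω ^ 2 + q ω ^ 2 + v ω ^ 2 := fun ω => by
    nlinarith [sq_nonneg (p ω), sq_nonneg (q ω)]
  have hq2 : ∀ ω, q ω ^ 2 ≤ 1 + p ω ^ 2 + q ω ^ 2 + v ω ^ 2 := fun ω => by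
    nlinarith [sq_nonneg (p ω), sq_nonneg (v ω)]
  have h0 : |(0:ℝ)| ≤ 1 := by simp
  have hqv : AEStronglyMeasurable (fun ω => q ω * v ω) P := hq.mul hv
  have hv1 : Integrable v P := (henv h0).integrable_of_abs_le hv hvT
  have hq1 : Integrable q P := (henv h0).integrable_of_abs_le hq hqT
  have hqv1 : Integrable (fun ω => q ω * v ω) P := (henv h0).integrable_of_abs_le hqv hqvT
  have hball : ∀ s ∈ Metric.ball (0:ℝ) 1, |s| ≤ 1 := fun s hs => by
    simpa using (Metric.mem_ball.1 hs).le
  set G' : ℝ → ℝ → ℝ := fun s x =>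
    smear P (fun u => u * stdPDF u) q (fun ω => p ω + s * q ω) x
      / smoothDensity P (fun ω => p ω + s * q ω) x
      * smear P (fun u => u * stdPDF u) v (fun ω => p ω + s * q ω) x
    + (1 + Real.log (smoothDensity P (fun ω => p ω + s * q ω) x))
      * smear P (fun u => (u ^ 2 - 1) * stdPDF u) (fun ω => q ω * v ω)
        (fun ω => p ω + s * q ω) x with hG'
  -- `7680 = 1536 + 6144`, from the quotient and the logarithmic term; integrating `(1 + x²)⁻¹`
  -- costs a factor `π < 4`, whence `30720`.
  have hbound : ∀ x, ∀ s ∈ Metric.ball (0:ℝ) 1, |G' s x| ≤ 7680 * M ^ 2 * (1 + x ^ 2)⁻¹ := by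
    intro x s hs
    have e := henv (hball s hs)
    refine (abs_add_le _ _).trans ((add_le_add (e.abs_smear_mul_smear_div_le hv hq hv2 hq2 x)
      (e.abs_mul_smear_le gaussDominated_sq_sub_one_mul_stdPDF hqv hqvT
        (e.abs_one_add_log_smoothDensity_le x))).trans (le_of_eq (by ring)))
  have key := (hasDerivAt_integral_of_dominated_loc_of_deriv_le (μ := volume) (x₀ := (0:ℝ))
    (F := fun s x => (1 + Real.log (smoothDensity P (fun ω => p ω + s * q ω) x))
      * smear P (fun u => u * stdPDF u) v (fun ω => p ω + s * q ω) x)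
    (F' := G') (bound := fun x => 7680 * M ^ 2 * (1 + x ^ 2)⁻¹)
    (Metric.ball_mem_nhds 0 one_pos)
    (Filter.eventually_of_mem (Metric.ball_mem_nhds 0 one_pos)
      fun s hs => ((henv (hball s hs)).integrable_entropyGrad gaussDominated_mul_stdPDF hv hvT).1)
    ((henv h0).integrable_entropyGrad gaussDominated_mul_stdPDF hv hvT)
    ?_ (Filter.Eventually.of_forall hbound)
    (integrable_inv_one_add_sq.const_mul _)
    (Filter.Eventually.of_forall fun x s hs => ?_)).2
  · refine ⟨_, key, (abs_integral_le_of_le_inv_one_add_sq (by positivity) fun x =>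
      hbound x 0 (Metric.mem_ball_self one_pos)).trans (le_of_eq (by ring))⟩
  · have e := henv h0
    refine Continuous.aestronglyMeasurable (Continuous.add (Continuous.mul (Continuous.div
      (e.continuous_smear gaussDominated_mul_stdPDF hq hqT) e.continuous_smoothDensity
        fun x => (e.smoothDensity_pos x).ne')
      (e.continuous_smear gaussDominated_mul_stdPDF hv hvT))
      ((continuous_const.add e.continuous_log_smoothDensity).mul
        (e.continuous_smear gaussDominated_sq_sub_one_mul_stdPDF hqv hqvT)))
  · have h1 := hasDerivAt_smear gaussDominated_stdPDF gaussDominated_mul_stdPDF hasDerivAt_stdPDF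
      hp hq (integrable_const (1:ℝ)) (by simpa using hq1) x s
    simp only [mul_one] at h1
    have h2 := hasDerivAt_smear gaussDominated_mul_stdPDF gaussDominated_sq_sub_one_mul_stdPDF
      hasDerivAt_mul_stdPDF hp hq hv1 hqv1 x s
    have hpos := (henv (hball s hs)).smoothDensity_pos x
    change HasDerivAt (fun s => smoothDensity P (fun ω => p ω + s * q ω) x) _ s at h1
    exact ((h1.log hpos.ne').const_add 1).mul h2

lemma Envelope.entropyGrad_add (h : Envelope P d T) (hv : AEStronglyMeasurable v P)
    (hw : AEStronglyMeasurable w P) (hvT : ∀ ω, |v ω| ≤ T ω) (hwT : ∀ ω, |w ω| ≤ T ω) :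
    entropyGrad P (fun ω => v ω + w ω) d = entropyGrad P v d + entropyGrad P w d := by
  rw [entropyGrad, entropyGrad, entropyGrad,
    ← integral_add (h.integrable_entropyGrad gaussDominated_mul_stdPDF hv hvT)
      (h.integrable_entropyGrad gaussDominated_mul_stdPDF hw hwT)]
  congr 1 with x
  rw [← mul_add]
  congr 1
  rw [smear, smear, smear, ← integral_add
    (integrable_smear gaussDominated_mul_stdPDF h.meas (h.integrable_of_abs_le hv hvT) x)
    (integrable_smear gaussDominated_mul_stdPDF h.meas (h.integrable_of_abs_le hw hwT) x)]
  congr 1 with ω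
  ring

end Entropy

/-! ### The gradient of `θ ↦ negEntropy` of the marginal, with dimension-free bounds. -/

section Vector

variable {Ω : Type*} [MeasurableSpace Ω] {P : Measure Ω} [IsProbabilityMeasure P]
  {E : Type*} [NormedAddCommGroup E] [InnerProductSpace ℝ E]

lemma add_pow_three_le {a b c : ℝ} (ha : 0 ≤ a) (hb : 0 ≤ b) (hc : 0 ≤ c) :
    (1 + a + b + c) ^ 3 ≤ 16 * (1 + a ^ 3 + b ^ 3 + c ^ 3) := by
  have key : ∀ {x y : ℝ}, 0 ≤ x → 0 ≤ y → (x + y) ^ 3 ≤ 4 * (x ^ 3 + y ^ 3) := fun {x y} hx hy => by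
    nlinarith [mul_nonneg (add_nonneg hx hy) (sq_nonneg (x - y))]
  have h1 := key (add_nonneg zero_le_one ha) (add_nonneg hb hc)
  have h2 := key zero_le_one ha
  have h3 := key hb hc
  rw [← add_assoc] at h1
  linarith

/-- All one-dimensional marginals of `X` in unit directions have sixth moment at most `m`. -/
structure SixthMomentLE (P : Measure Ω) (X : Ω → E) (m : ℝ) : Prop where
  meas : ∀ u, AEStronglyMeasurable (fun ω => inner ℝ (X ω) u) P
  integrable : ∀ u, ‖u‖ = 1 → Integrable (fun ω => inner ℝ (X ω) u ^ 6) P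
  le : ∀ u, ‖u‖ = 1 → ∫ ω, inner ℝ (X ω) u ^ 6 ∂P ≤ m
  nonneg : 0 ≤ m

variable {X : Ω → E} {m : ℝ}

lemma SixthMomentLE.integrable_and_le (h : SixthMomentLE P X m) (θ : E) :
    Integrable (fun ω => inner ℝ (X ω) θ ^ 6) P ∧
      ∫ ω, inner ℝ (X ω) θ ^ 6 ∂P ≤ m * ‖θ‖ ^ 6 := by
  rcases eq_or_ne θ 0 with rfl | hθ
  · simp
  have hn : ‖θ‖ ≠ 0 := norm_ne_zero_iff.2 hθ
  have hu : ‖(‖θ‖⁻¹ : ℝ) • θ‖ = 1 := by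
    rw [norm_smul, norm_inv, norm_norm, inv_mul_cancel₀ hn]
  have e : (fun ω => inner ℝ (X ω) θ ^ 6)
      = fun ω => ‖θ‖ ^ 6 * inner ℝ (X ω) ((‖θ‖⁻¹ : ℝ) • θ) ^ 6 := by
    ext ω
    rw [inner_smul_right, ← mul_pow, mul_inv_cancel_left₀ hn]
  rw [e, integral_const_mul, mul_comm m]
  exact ⟨(h.integrable _ hu).const_mul _, mul_le_mul_of_nonneg_left (h.le _ hu) (by positivity)⟩

lemma SixthMomentLE.integrable_cube_and_le (h : SixthMomentLE P X m) (θ w v : E) :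
    Integrable (fun ω => (1 + inner ℝ (X ω) θ ^ 2 + inner ℝ (X ω) w ^ 2
      + inner ℝ (X ω) v ^ 2) ^ 3) P ∧
    ∫ ω, (1 + inner ℝ (X ω) θ ^ 2 + inner ℝ (X ω) w ^ 2 + inner ℝ (X ω) v ^ 2) ^ 3 ∂P
      ≤ 16 * (1 + m * ‖θ‖ ^ 6 + m * ‖w‖ ^ 6 + m * ‖v‖ ^ 6) := by
  obtain ⟨i1, l1⟩ := h.integrable_and_le θ
  obtain ⟨i2, l2⟩ := h.integrable_and_le w
  obtain ⟨i3, l3⟩ := h.integrable_and_le v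
  have hle : ∀ ω, (1 + inner ℝ (X ω) θ ^ 2 + inner ℝ (X ω) w ^ 2 + inner ℝ (X ω) v ^ 2) ^ 3
      ≤ 16 * (1 + inner ℝ (X ω) θ ^ 6 + inner ℝ (X ω) w ^ 6 + inner ℝ (X ω) v ^ 6) := fun ω => by
    refine (add_pow_three_le (sq_nonneg _) (sq_nonneg _) (sq_nonneg _)).trans (le_of_eq ?_)
    simp only [← pow_mul]
  have i12 := ((integrable_const (μ := P) (1 : ℝ)).add i1)
  have i123 := i12.add i2
  have iall := i123.add i3
  have hint : Integrable (fun ω => (1 + inner ℝ (X ω) θ ^ 2 + inner ℝ (X ω) w ^ 2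
      + inner ℝ (X ω) v ^ 2) ^ 3) P := by
    refine (iall.const_mul 16).mono' ((((aestronglyMeasurable_const.add ((h.meas θ).pow 2)).add
      ((h.meas w).pow 2)).add ((h.meas v).pow 2)).pow 3) (Filter.Eventually.of_forall fun ω => ?_)
    rw [Real.norm_of_nonneg (by positivity)]
    exact hle ω
  refine ⟨hint, (integral_mono hint (iall.const_mul 16) hle).trans ?_⟩
  rw [integral_const_mul, integral_add' i123 i3, integral_add' i12 i2, integral_add' _ i1]
  · simp only [integral_const, probReal_univ, smul_eq_mul, mul_one]
    linarith
  · exact integrable_const _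

lemma SixthMomentLE.envelope (h : SixthMomentLE P X m) (θ w v : E) :
    Envelope P (fun ω => inner ℝ (X ω) θ) (fun ω => 1 + inner ℝ (X ω) θ ^ 2 + inner ℝ (X ω) w ^ 2
      + inner ℝ (X ω) v ^ 2) := by
  simpa using envelope_line (s := 0) (h.meas θ) (h.meas w) (h.integrable_cube_and_le θ w v).1
    (by simp)

lemma abs_le_one_add_sq_add (x a b : ℝ) : |x| ≤ 1 + a ^ 2 + b ^ 2 + x ^ 2 := by
  rw [← sq_abs x]; nlinarith [sq_nonneg (|x| - 1), sq_nonneg a, sq_nonneg b]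

lemma abs_le_one_add_sq_add' (x a b : ℝ) : |x| ≤ 1 + a ^ 2 + x ^ 2 + b ^ 2 := by
  rw [← sq_abs x]; nlinarith [sq_nonneg (|x| - 1), sq_nonneg a, sq_nonneg b]

/-- The directional derivative is linear in `v`, so the Riesz representation applies. -/
lemma SixthMomentLE.exists_gradient_vector [CompleteSpace E] [FiniteDimensional ℝ E]
    (h : SixthMomentLE P X m) (θ : E) :
    ∃ D : E, ∀ v, inner ℝ D v
      = entropyGrad P (fun ω => inner ℝ (X ω) v) (fun ω => inner ℝ (X ω) θ) := by
  let f : E →ₗ[ℝ] ℝ :=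
    { toFun := fun v => entropyGrad P (fun ω => inner ℝ (X ω) v) (fun ω => inner ℝ (X ω) θ)
      map_add' := fun v w => by
        simp only [inner_add_right]
        exact (h.envelope θ w v).entropyGrad_add (h.meas v) (h.meas w)
          (fun ω => abs_le_one_add_sq_add _ _ _) (fun ω => abs_le_one_add_sq_add' _ _ _)
      map_smul' := fun c v => by
        simp only [inner_smul_right]
        exact entropyGrad_const_mul c }
  refine ⟨(InnerProductSpace.toDual ℝ E).symm (LinearMap.toContinuousLinearMap f), fun v => ?_⟩
  rw [InnerProductSpace.toDual_symm_apply]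
  rfl

lemma norm_le_of_forall_unit_inner_le {x : E} {B : ℝ} (hB : 0 ≤ B)
    (h : ∀ v : E, ‖v‖ = 1 → |inner ℝ x v| ≤ B) : ‖x‖ ≤ B := by
  rcases eq_or_ne x 0 with rfl | hx
  · simpa using hB
  have hn : ‖x‖ ≠ 0 := norm_ne_zero_iff.2 hx
  have := h ((‖x‖⁻¹ : ℝ) • x) (by rw [norm_smul, norm_inv, norm_norm, inv_mul_cancel₀ hn])
  rwa [inner_smul_right, real_inner_self_eq_norm_sq, pow_two, inv_mul_cancel_left₀ hn,
    abs_norm] at this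

/-- The bound on the gradient of the entropy and on its Lipschitz constant in a ball. -/
noncomputable def entropyBound (m R : ℝ) : ℝ := 30720 * (16 * (1 + m * R ^ 6 + m + m)) ^ 2

lemma SixthMomentLE.sq_integral_le (h : SixthMomentLE P X m) {θ w v : E} {R : ℝ} (hθ : ‖θ‖ ≤ R)
    (hw : ‖w‖ = 1) (hv : ‖v‖ = 1) :
    (∫ ω, (1 + inner ℝ (X ω) θ ^ 2 + inner ℝ (X ω) w ^ 2 + inner ℝ (X ω) v ^ 2) ^ 3 ∂P) ^ 2
      ≤ (16 * (1 + m * R ^ 6 + m + m)) ^ 2 := by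
  have := h.nonneg
  have h2 := (h.integrable_cube_and_le θ w v).2
  rw [hw, hv, one_pow, mul_one] at h2
  refine pow_le_pow_left₀ (integral_nonneg fun ω => by positivity) (h2.trans ?_) 2
  gcongr

lemma SixthMomentLE.abs_entropyGrad_le (h : SixthMomentLE P X m) {θ v : E} {R : ℝ} (hθ : ‖θ‖ ≤ R)
    (hv : ‖v‖ = 1) :
    |entropyGrad P (fun ω => inner ℝ (X ω) v) (fun ω => inner ℝ (X ω) θ)| ≤ entropyBound m R := by
  refine ((h.envelope θ v v).abs_entropyGrad_le (h.meas v)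
    fun ω => abs_le_one_add_sq_add _ _ _).trans ?_
  rw [entropyBound]
  have := h.sq_integral_le hθ hv hv
  nlinarith [sq_nonneg (16 * (1 + m * R ^ 6 + m + m))]

lemma inner_line (x θ w : E) (s s' : ℝ) :
    inner ℝ x (θ + s • w) + (s' - s) * inner ℝ x w = inner ℝ x (θ + s' • w) := by
  simp only [inner_add_right, inner_smul_right]; ring

lemma norm_line_le {θ θ' h : E} {R s : ℝ} (hθ : ‖θ‖ ≤ R) (hθ' : ‖θ'‖ ≤ R) (h0 : 0 ≤ s) (h1 : s ≤ 1)
    (hh : θ' = θ + h) : ‖θ + s • h‖ ≤ R := by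
  have : θ + s • h = (1 - s) • θ + s • θ' := by rw [hh]; module
  rw [this]
  refine (norm_add_le _ _).trans ?_
  rw [norm_smul, norm_smul, Real.norm_of_nonneg h0, Real.norm_of_nonneg (sub_nonneg.2 h1)]
  nlinarith

/-- Mean value inequality on the segment from `θ` to `θ'`, which stays in the ball of radius `R` by
convexity. -/
lemma SixthMomentLE.abs_entropyGrad_sub_le (h : SixthMomentLE P X m) {θ θ' v : E} {R : ℝ}
    (hθ : ‖θ‖ ≤ R) (hθ' : ‖θ'‖ ≤ R) (hv : ‖v‖ = 1) :
    |entropyGrad P (fun ω => inner ℝ (X ω) v) (fun ω => inner ℝ (X ω) θ')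
      - entropyGrad P (fun ω => inner ℝ (X ω) v) (fun ω => inner ℝ (X ω) θ)|
      ≤ entropyBound m R * ‖θ' - θ‖ := by
  rcases eq_or_ne θ' θ with rfl | hne
  · simp
  set l := ‖θ' - θ‖ with hl
  have hl0 : 0 < l := norm_pos_iff.2 (sub_ne_zero.2 hne)
  -- Arc-length parametrization: the moment bounds are used for unit directions, and the length `l`
  -- supplies the factor `‖θ' - θ‖`.
  set w := l⁻¹ • (θ' - θ) with hw
  have hw1 : ‖w‖ = 1 := by rw [hw, norm_smul, norm_inv, Real.norm_of_nonneg hl0.le, ← hl,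
    inv_mul_cancel₀ hl0.ne']
  have hlw : l • w = θ' - θ := by rw [hw, smul_inv_smul₀ hl0.ne']
  have hderiv : ∀ s : ℝ, ∃ g, HasDerivAt (fun s : ℝ => entropyGrad P (fun ω => inner ℝ (X ω) v)
      (fun ω => inner ℝ (X ω) (θ + s • w))) g s ∧ (s ∈ Set.Icc 0 l → |g| ≤ entropyBound m R) := by
    intro s
    obtain ⟨g, hg, hgb⟩ := exists_hasDerivAt_entropyGrad (h.meas (θ + s • w)) (h.meas w) (h.meas v)
      (h.integrable_cube_and_le (θ + s • w) w v).1
    refine ⟨g, ?_, fun hs => hgb.trans ?_⟩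
    · have := HasDerivAt.comp_sub_const s s (by rwa [sub_self])
        (f := fun s' : ℝ => entropyGrad P (fun ω => inner ℝ (X ω) v)
          (fun ω => inner ℝ (X ω) (θ + s • w) + s' * inner ℝ (X ω) w))
      simpa only [inner_line] using this
    · refine mul_le_mul_of_nonneg_left (h.sq_integral_le ?_ hw1 hv) (by norm_num)
      have e : s • w = (s / l) • (θ' - θ) := by
        rw [hw, smul_smul, div_eq_mul_inv]
      rw [e]
      exact norm_line_le hθ hθ' (div_nonneg hs.1 hl0.le) ((div_le_one hl0).2 hs.2) (by abel)
  choose g hg hgb using hderiv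
  have key := norm_image_sub_le_of_norm_deriv_le_segment' (a := 0) (b := l)
    (fun s _ => (hg s).hasDerivWithinAt) (fun s hs => hgb s ⟨hs.1, hs.2.le⟩) l ⟨hl0.le, le_rfl⟩
  simpa [hlw] using key

lemma SixthMomentLE.hasDerivAt_negEntropy_line (h : SixthMomentLE P X m) (θ w : E) (s : ℝ) :
    HasDerivAt (fun s : ℝ => negEntropy P (fun ω => inner ℝ (X ω) (θ + s • w)))
      (entropyGrad P (fun ω => inner ℝ (X ω) w) (fun ω => inner ℝ (X ω) (θ + s • w))) s := by
  have hg := hasDerivAt_negEntropy (h.meas (θ + s • w)) (h.meas w)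
      (h.integrable_cube_and_le (θ + s • w) w w).1
  have := HasDerivAt.comp_sub_const s s (by rwa [sub_self])
    (f := fun s' : ℝ => negEntropy P
      (fun ω => inner ℝ (X ω) (θ + s • w) + s' * inner ℝ (X ω) w))
  simpa only [inner_line] using this

/-- Along the segment to `θ + w` the first-order remainder has derivative at most `B‖w‖²`, so it is
`O(‖w‖²)` and hence `o(‖w‖)`. -/
lemma hasGradientAt_of_lipschitz_line [CompleteSpace E] {f : E → ℝ} {D : E → E} {θ : E} {B : ℝ}
    (hf : ∀ w (s : ℝ), HasDerivAt (fun s : ℝ => f (θ + s • w)) (inner ℝ (D (θ + s • w)) w) s)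
    (hD : ∀ w, ‖w‖ ≤ 1 → ‖D (θ + w) - D θ‖ ≤ B * ‖w‖) : HasGradientAt f (D θ) θ := by
  rw [hasGradientAt_iff_hasFDerivAt, hasFDerivAt_iff_isLittleO_nhds_zero]
  refine Asymptotics.IsBigO.trans_isLittleO (g := fun w : E => ‖w‖ ^ 2)
    (Asymptotics.IsBigO.of_bound B ?_) (Asymptotics.isLittleO_norm_pow_id one_lt_two)
  filter_upwards [Metric.ball_mem_nhds (0 : E) one_pos] with w hw
  have hw1 : ‖w‖ ≤ 1 := by simpa using (Metric.mem_ball.1 hw).le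
  have key := norm_image_sub_le_of_norm_deriv_le_segment' (a := 0) (b := 1)
    (f := fun s : ℝ => f (θ + s • w) - s * inner ℝ (D θ) w) (C := B * ‖w‖ ^ 2)
    (fun s _ => ((hf w s).sub ((hasDerivAt_id s).mul_const _)).hasDerivWithinAt)
    (fun s hs => ?_) 1 ⟨zero_le_one, le_rfl⟩
  · simp only [one_smul, zero_smul, add_zero, one_mul, zero_mul, sub_zero, mul_one] at key
    rw [InnerProductSpace.toDual_apply_apply, norm_pow, norm_norm]
    convert key using 2
    ring
  · have hsw : ‖s • w‖ ≤ ‖w‖ := by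
      rw [norm_smul, Real.norm_of_nonneg hs.1]
      exact mul_le_of_le_one_left (norm_nonneg _) hs.2.le
    rw [one_mul, ← inner_sub_left]
    refine (norm_inner_le_norm _ _).trans ?_
    have h1 := hD (s • w) (hsw.trans hw1)
    rw [pow_two, ← mul_assoc]
    refine mul_le_mul_of_nonneg_right (h1.trans ?_) (norm_nonneg _)
    -- The sign of `B` is not given; unless `s • w = 0`, the bound `h1` forces `B ≥ 0`.
    rcases (norm_nonneg (s • w)).eq_or_lt with h0 | h0
    · have hB : 0 ≤ B * ‖w‖ := (norm_nonneg _).trans (hD w hw1)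
      rw [← h0, mul_zero]; exact hB
    · exact mul_le_mul_of_nonneg_left hsw
        (nonneg_of_mul_nonneg_left ((norm_nonneg _).trans h1) h0)

theorem SixthMomentLE.exists_gradient [CompleteSpace E] [FiniteDimensional ℝ E]
    (h : SixthMomentLE P X m) :
    ∃ D : E → E, (∀ θ, HasGradientAt
      (fun θ => negEntropy P (fun ω => inner ℝ (X ω) θ)) (D θ) θ) ∧
      (∀ R θ, ‖θ‖ ≤ R → ‖D θ‖ ≤ entropyBound m R) ∧
      (∀ R θ θ', ‖θ‖ ≤ R → ‖θ'‖ ≤ R → ‖D θ' - D θ‖ ≤ entropyBound m R * ‖θ' - θ‖) := by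
  choose D hD using h.exists_gradient_vector
  have hB : ∀ R, 0 ≤ entropyBound m R := fun R => by rw [entropyBound]; positivity
  have hlip : ∀ R θ θ', ‖θ‖ ≤ R → ‖θ'‖ ≤ R →
      ‖D θ' - D θ‖ ≤ entropyBound m R * ‖θ' - θ‖ := fun R θ θ' hθ hθ' => by
    refine norm_le_of_forall_unit_inner_le (mul_nonneg (hB R) (norm_nonneg _)) fun v hv => ?_
    rw [inner_sub_left, hD, hD]
    exact h.abs_entropyGrad_sub_le hθ hθ' hv
  refine ⟨D, fun θ => ?_, fun R θ hθ => ?_, hlip⟩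
  -- Radius `‖θ‖ + 1` contains the unit ball about `θ`.
  · refine hasGradientAt_of_lipschitz_line (B := entropyBound m (‖θ‖ + 1)) (fun w s => ?_)
      fun w hw => ?_
    · rw [hD]
      exact h.hasDerivAt_negEntropy_line θ w s
    · have := hlip (‖θ‖ + 1) θ (θ + w) (by linarith) ((norm_add_le _ _).trans (by linarith))
      rwa [add_sub_cancel_left] at this
  · refine norm_le_of_forall_unit_inner_le (hB R) fun v hv => ?_
    rw [hD]
    exact h.abs_entropyGrad_le hθ hv

end Vector

/-! ### Sixth moments from subgaussian tails. -/

section Subgaussian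

variable {Ω : Type*} [MeasurableSpace Ω] {P : Measure Ω} [IsProbabilityMeasure P]

lemma integral_pow_five_mul_exp {K : ℝ} (hK : 0 < K) :
    IntegrableOn (fun t : ℝ => t ^ (5:ℝ) * Real.exp (-(K ^ 2)⁻¹ * t ^ (2:ℝ))) (Set.Ioi 0) ∧
    ∫ t in Set.Ioi (0:ℝ), t ^ (5:ℝ) * Real.exp (-(K ^ 2)⁻¹ * t ^ (2:ℝ)) = K ^ 6 := by
  have hb : 0 < (K ^ 2)⁻¹ := by positivity
  refine ⟨integrableOn_rpow_mul_exp_neg_mul_rpow (by norm_num) (by norm_num) hb, ?_⟩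
  rw [integral_rpow_mul_exp_neg_mul_rpow (by norm_num) (by norm_num) hb]
  have h1 : Real.Gamma ((5 + 1) / 2) = 2 := by
    have := Real.Gamma_nat_eq_factorial 2
    norm_num [Nat.factorial] at this ⊢
  have h2 : (-(5 + 1) / 2 : ℝ) = ((-3 : ℤ) : ℝ) := by norm_num
  rw [h1, h2, Real.rpow_intCast]
  simp [zpow_neg]
  ring

/-- Layer cake: `E W⁶ = 6 ∫ t⁵ P[|W| ≥ t] dt ≤ 12 ∫ t⁵ exp (-t² / K²) dt`, and the last integral is
`K⁶ Γ(3) / 2 = K⁶`. -/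
lemma IsSubgaussian.sixth_moment {K : ℝ} {W : Ω → ℝ} (h : IsSubgaussian P K W) (hK : 0 < K)
    (hW : AEMeasurable W P) :
    Integrable (fun ω => W ω ^ 6) P ∧ ∫ ω, W ω ^ 6 ∂P ≤ 12 * K ^ 6 := by
  have e : ∀ ω, W ω ^ 6 = |W ω| ^ (6:ℝ) := fun ω => by
    rw [show (6:ℝ) = ((6:ℕ):ℝ) by norm_num, Real.rpow_natCast, Even.pow_abs (by decide)]
  obtain ⟨hi, hint⟩ := integral_pow_five_mul_exp hK
  have key : ∫⁻ ω, ENNReal.ofReal (W ω ^ 6) ∂P ≤ ENNReal.ofReal (12 * K ^ 6) := by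
    simp_rw [e]
    rw [lintegral_rpow_eq_lintegral_meas_le_mul P (Filter.Eventually.of_forall fun ω =>
      abs_nonneg (W ω)) hW.abs (by norm_num : (0:ℝ) < 6)]
    have : ∫⁻ t in Set.Ioi (0:ℝ), P {ω | t ≤ |W ω|} * ENNReal.ofReal (t ^ ((6:ℝ) - 1))
        ≤ ENNReal.ofReal (2 * K ^ 6) := by
      rw [← hint, ← integral_const_mul, ofReal_integral_eq_lintegral_ofReal (hi.const_mul 2)]
      · refine setLIntegral_mono' measurableSet_Ioi fun t ht => ?_
        have ht0 : (0:ℝ) < t := ht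
        have h1 := h t ht0
        rw [← ofReal_measureReal, ← ENNReal.ofReal_mul measureReal_nonneg]
        refine ENNReal.ofReal_le_ofReal ?_
        have e1 : (6:ℝ) - 1 = 5 := by norm_num
        have e2 : -(K ^ 2)⁻¹ * t ^ (2:ℝ) = -t ^ 2 / K ^ 2 := by
          rw [Real.rpow_two]; field_simp
        rw [e1, e2]
        calc _ ≤ (2 * Real.exp (-t ^ 2 / K ^ 2)) * t ^ (5:ℝ) := by gcongr
          _ = _ := by ring
      · filter_upwards [self_mem_ae_restrict measurableSet_Ioi] with t ht
        have ht0 : (0:ℝ) < t := ht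
        simp only [Pi.zero_apply]
        positivity
    calc _ ≤ ENNReal.ofReal 6 * ENNReal.ofReal (2 * K ^ 6) := by gcongr
      _ = _ := by rw [← ENNReal.ofReal_mul (by norm_num)]; congr 1; ring
  have hnn : ∀ᵐ ω ∂P, 0 ≤ W ω ^ 6 := Filter.Eventually.of_forall fun ω => by positivity
  have hm : AEStronglyMeasurable (fun ω => W ω ^ 6) P := (hW.pow_const 6).aestronglyMeasurable
  refine ⟨⟨hm, ?_⟩, ?_⟩
  · rw [hasFiniteIntegral_iff_ofReal hnn]
    exact key.trans_lt ENNReal.ofReal_lt_top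
  · rw [integral_eq_lintegral_of_nonneg_ae hnn hm]
    exact ENNReal.toReal_le_of_le_ofReal (by positivity) key

end Subgaussian

/-! ### Density and relative entropy of a variable plus independent Gaussian noise. -/

section Density

variable {Ω : Type*} [MeasurableSpace Ω] {P : Measure Ω} [IsProbabilityMeasure P]
  {A G T : Ω → ℝ} {σ : ℝ}

lemma gaussianPDFReal_eq_stdPDF (hσ : 0 < σ) (a x : ℝ) :
    gaussianPDFReal a (Real.toNNReal (σ ^ 2)) x = σ⁻¹ * stdPDF (x / σ - a / σ) := by
  rw [stdPDF_eq, gaussianPDFReal, Real.coe_toNNReal _ (sq_nonneg σ),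
    Real.sqrt_mul (by positivity), Real.sqrt_sq hσ.le, mul_inv, ← mul_assoc,
    mul_comm (Real.sqrt _)⁻¹]
  congr 2
  field_simp

/-- The density of `A + N(0,σ²)`. -/
noncomputable def scaledDensity (P : Measure Ω) (σ : ℝ) (A : Ω → ℝ) (x : ℝ) : ℝ :=
  σ⁻¹ * smoothDensity P (fun ω => A ω / σ) (x / σ)

lemma lintegral_gaussianPDF_eq (hσ : 0 < σ) (hA : AEMeasurable A P) (x : ℝ) :
    ∫⁻ ω, gaussianPDF (A ω) (Real.toNNReal (σ ^ 2)) x ∂P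
      = ENNReal.ofReal (scaledDensity P σ A x) := by
  have hi := integrable_smear gaussDominated_stdPDF
    (hA.div_const σ).aestronglyMeasurable (integrable_const (μ := P) (1:ℝ)) (x / σ)
  rw [scaledDensity, smoothDensity, smear, ← integral_const_mul,
    ofReal_integral_eq_lintegral_ofReal (hi.const_mul _)]
  · refine lintegral_congr fun ω => ?_
    rw [gaussianPDF, gaussianPDFReal_eq_stdPDF hσ, mul_one]
  · refine Filter.Eventually.of_forall fun ω => ?_
    have := (stdPDF_pos (x / σ - A ω / σ)).le
    simp only [Pi.zero_apply, mul_one]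
    positivity

/-- The law of the sum is a convolution; Tonelli exchanges the average over `A` with the integral of
the translated Gaussian density. -/
lemma map_add_gaussian_eq_withDensity (hσ : 0 < σ) (hA : AEMeasurable A P)
    (hG : HasLaw G (gaussianReal 0 (Real.toNNReal (σ ^ 2))) P) (hind : IndepFun A G P) :
    P.map (fun ω => A ω + G ω)
      = volume.withDensity (fun x => ENNReal.ofReal (scaledDensity P σ A x)) := by
  have hv : Real.toNNReal (σ ^ 2) ≠ 0 := by
    rw [Ne, Real.toNNReal_eq_zero, not_le]; positivity
  have h1 : P.map (fun ω => A ω + G ω) = (P.map A) ∗ (P.map G) :=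
    hind.map_add_eq_map_conv_map₀ hA hG.aemeasurable
  have : IsProbabilityMeasure (P.map A) := Measure.isProbabilityMeasure_map hA
  rw [h1, hG.map_eq]
  refine Measure.ext_of_lintegral _ fun f hf => ?_
  have hmeas : Measurable (fun z : ℝ × ℝ => gaussianPDF z.1 (Real.toNNReal (σ ^ 2)) z.2) :=
    measurable_uncurry_gaussianPDF.comp
      (measurable_fst.prodMk (measurable_const.prodMk measurable_snd))
  have hdens : (fun x => ENNReal.ofReal (scaledDensity P σ A x))
      = fun x => ∫⁻ a, gaussianPDF a (Real.toNNReal (σ ^ 2)) x ∂(P.map A) := by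
    ext x
    rw [← lintegral_gaussianPDF_eq hσ hA, lintegral_map' _ hA]
    exact (hmeas.comp (measurable_id.prodMk measurable_const)).aemeasurable
  rw [hdens, lintegral_withDensity_eq_lintegral_mul _ hmeas.lintegral_prod_left' hf,
    Measure.lintegral_conv hf]
  have hinner : ∀ a, ∫⁻ y, f (a + y) ∂(gaussianReal 0 (Real.toNNReal (σ ^ 2)))
      = ∫⁻ x, gaussianPDF a (Real.toNNReal (σ ^ 2)) x * f x := fun a => by
    rw [← lintegral_map hf (measurable_const_add a), gaussianReal_map_const_add, zero_add,
      gaussianReal_of_var_ne_zero _ hv,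
      lintegral_withDensity_eq_lintegral_mul _ (measurable_gaussianPDF _ _) hf]
    rfl
  simp_rw [hinner]
  rw [lintegral_lintegral_swap]
  · refine lintegral_congr fun x => ?_
    have hx : Measurable fun a => gaussianPDF a (Real.toNNReal (σ ^ 2)) x :=
      Measurable.of_uncurry_right (f := fun a x => gaussianPDF a (Real.toNNReal (σ ^ 2)) x) hmeas
    rw [Pi.mul_apply]
    exact lintegral_mul_const (f x) hx
  · exact (hmeas.mul (hf.comp measurable_snd)).aemeasurable

lemma scaledDensity_log (hσ : 0 < σ) (h : Envelope P (fun ω => A ω / σ) T) (x : ℝ) :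
    scaledDensity P σ A x * Real.log (scaledDensity P σ A x / gaussianPDFReal 0 1 x)
      = σ⁻¹ * (smoothDensity P (fun ω => A ω / σ) (x / σ)
          * Real.log (smoothDensity P (fun ω => A ω / σ) (x / σ)))
        + (Real.log (Real.sqrt (2 * Real.pi)) - Real.log σ) * scaledDensity P σ A x
        + 2⁻¹ * (scaledDensity P σ A x * x ^ 2) := by
  have hF := h.smoothDensity_pos (x / σ)
  have h2 : gaussianPDFReal 0 1 x = stdPDF x := rfl
  rw [scaledDensity, Real.log_div (by positivity) (by rw [h2]; exact (stdPDF_pos x).ne'),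
    h2, stdPDF_eq, Real.log_mul (by positivity) hF.ne', Real.log_inv,
    Real.log_mul (by positivity) (Real.exp_pos _).ne', Real.log_exp, Real.log_inv]
  ring

/-- `scaledDensity_log` splits the integrand into three: the first becomes `negEntropy` under `x =
σy`, the second is a constant times the total mass, the third half the second moment. -/
theorem relEntropy_add_gaussian (hσ : 0 < σ) (hA : AEMeasurable A P)
    (hG : HasLaw G (gaussianReal 0 (Real.toNNReal (σ ^ 2))) P) (hind : IndepFun A G P)
    (h : Envelope P (fun ω => A ω / σ) T)
    (hsq : Integrable (fun ω => (A ω + G ω) ^ 2) P) :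
    HasPDF (fun ω => A ω + G ω) P volume ∧
    Integrable (relEntropyIntegrand P (fun ω => A ω + G ω)) volume ∧
    relEntropy P (fun ω => A ω + G ω)
      = negEntropy P (fun ω => A ω / σ) + (Real.log (Real.sqrt (2 * Real.pi)) - Real.log σ)
        + 2⁻¹ * ∫ ω, (A ω + G ω) ^ 2 ∂P := by
  have hmap := map_add_gaussian_eq_withDensity hσ hA hG hind
  have hcont : Continuous (scaledDensity P σ A) :=
    continuous_const.mul (h.continuous_smoothDensity.comp (continuous_id.div_const σ))
  have hm : AEMeasurable (fun x => ENNReal.ofReal (scaledDensity P σ A x)) :=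
    hcont.measurable.ennreal_ofReal.aemeasurable
  have hpdf : HasPDF (fun ω => A ω + G ω) P volume :=
    hasPDF_of_map_eq_withDensity (hA.add hG.aemeasurable) _ hm hmap
  have hdens : density P (fun ω => A ω + G ω) =ᵐ[volume] scaledDensity P σ A := by
    filter_upwards [(pdf.eq_of_map_eq_withDensity _ hm).1 hmap] with x hx
    rw [density, hx, ENNReal.toReal_ofReal]
    exact mul_nonneg (inv_nonneg.2 hσ.le) (h.smoothDensity_pos _).le
  have hint : ∀ f : ℝ → ℝ, Continuous f → Integrable (fun ω => f (A ω + G ω)) P →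
      Integrable (fun x => scaledDensity P σ A x * f x) ∧
      ∫ x, scaledDensity P σ A x * f x = ∫ ω, f (A ω + G ω) ∂P := by
    intro f hf hfi
    have he : (fun x => (pdf (fun ω => A ω + G ω) P volume x).toReal • f x)
        =ᵐ[volume] fun x => scaledDensity P σ A x * f x := by
      filter_upwards [hdens] with x hx
      rw [← hx]; rfl
    refine ⟨((pdf.integrable_pdf_smul_iff hf.aestronglyMeasurable).2 hfi).congr he, ?_⟩
    rw [← integral_congr_ae he, pdf.integral_pdf_smul hf.aestronglyMeasurable]
  obtain ⟨i1, e1⟩ := hint (fun _ => 1) continuous_const (integrable_const _)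
  obtain ⟨i2, e2⟩ := hint (fun x => x ^ 2) (continuous_pow 2) hsq
  simp only [mul_one, integral_const, probReal_univ, smul_eq_mul] at i1 e1
  have i0 : Integrable (fun x => σ⁻¹ * (smoothDensity P (fun ω => A ω / σ) (x / σ)
      * Real.log (smoothDensity P (fun ω => A ω / σ) (x / σ)))) :=
    (h.integrable_negEntropy.comp_div hσ.ne').const_mul _
  have e0 : ∫ x, σ⁻¹ * (smoothDensity P (fun ω => A ω / σ) (x / σ)
      * Real.log (smoothDensity P (fun ω => A ω / σ) (x / σ)))
      = negEntropy P (fun ω => A ω / σ) := by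
    rw [integral_const_mul, Measure.integral_comp_div
      (fun x => smoothDensity P (fun ω => A ω / σ) x
        * Real.log (smoothDensity P (fun ω => A ω / σ) x)), abs_of_pos hσ, smul_eq_mul,
      inv_mul_cancel_left₀ hσ.ne']
    rfl
  have i01 : Integrable fun x => σ⁻¹ * (smoothDensity P (fun ω => A ω / σ) (x / σ)
        * Real.log (smoothDensity P (fun ω => A ω / σ) (x / σ)))
      + (Real.log (Real.sqrt (2 * Real.pi)) - Real.log σ) * scaledDensity P σ A x := i0.add (i1.const_mul (Real.log (Real.sqrt (2 * Real.pi)) - Real.log σ))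
  have hre : relEntropyIntegrand P (fun ω => A ω + G ω) =ᵐ[volume] fun x =>
      σ⁻¹ * (smoothDensity P (fun ω => A ω / σ) (x / σ)
          * Real.log (smoothDensity P (fun ω => A ω / σ) (x / σ)))
        + (Real.log (Real.sqrt (2 * Real.pi)) - Real.log σ) * scaledDensity P σ A x
        + 2⁻¹ * (scaledDensity P σ A x * x ^ 2) := by
    filter_upwards [hdens] with x hx
    rw [relEntropyIntegrand, hx, scaledDensity_log hσ h]
  refine ⟨hpdf, (i01.add (i2.const_mul 2⁻¹)).congr hre.symm, ?_⟩
  rw [relEntropy, integral_congr_ae hre, integral_add i01 (i2.const_mul 2⁻¹),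
    integral_add i0 (i1.const_mul _), e0, integral_const_mul, integral_const_mul, e1, e2, mul_one]

end Density

/-! ### Calculus of bounded Lipschitz maps and the radial change of variables. -/

section BoundedLipschitz

variable {E F : Type*} [NormedAddCommGroup E] [NormedAddCommGroup F]

/-- `f` is bounded by `M` and `L`-Lipschitz on `s`. -/
structure BoundedLipschitzOn (s : Set E) (f : E → F) (M L : ℝ) : Prop where
  norm_le : ∀ a ∈ s, ‖f a‖ ≤ M
  sub_le : ∀ a ∈ s, ∀ b ∈ s, ‖f a - f b‖ ≤ L * ‖a - b‖

variable {s : Set E} {f g : E → F} {φ : E → ℝ} {M L M' L' r : ℝ}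

lemma BoundedLipschitzOn.sub (hf : BoundedLipschitzOn s f M L) (hg : BoundedLipschitzOn s g M' L') :
    BoundedLipschitzOn s (fun a => f a - g a) (M + M') (L + L') where
  norm_le a ha := (norm_sub_le _ _).trans (add_le_add (hf.norm_le a ha) (hg.norm_le a ha))
  sub_le a ha b hb := by
    rw [sub_sub_sub_comm, add_mul]
    exact (norm_sub_le _ _).trans (add_le_add (hf.sub_le a ha b hb) (hg.sub_le a ha b hb))

lemma boundedLipschitzOn_inv_norm (hr : 0 < r) :
    BoundedLipschitzOn {a : F | r ≤ ‖a‖} (fun a => ‖a‖⁻¹) r⁻¹ (r⁻¹ * r⁻¹) where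
  norm_le a ha := by
    rw [norm_inv, norm_norm]
    exact inv_anti₀ hr ha
  sub_le a ha b hb := by
    have ha0 : 0 < ‖a‖ := hr.trans_le ha
    have hb0 : 0 < ‖b‖ := hr.trans_le hb
    rw [inv_sub_inv ha0.ne' hb0.ne', norm_div, Real.norm_eq_abs, Real.norm_eq_abs,
      abs_of_pos (mul_pos ha0 hb0), div_eq_mul_inv, mul_inv, mul_comm]
    have h1 := inv_anti₀ hr ha
    have h2 := inv_anti₀ hr hb
    have h3 := abs_norm_sub_norm_le b a
    rw [norm_sub_rev] at h3
    gcongr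

variable [InnerProductSpace ℝ F]

lemma BoundedLipschitzOn.smul (hφ : BoundedLipschitzOn s φ M L)
    (hf : BoundedLipschitzOn s f M' L') :
    BoundedLipschitzOn s (fun a => φ a • f a) (M * M') (M * L' + L * M') where
  norm_le a ha := by
    rw [norm_smul]
    exact mul_le_mul (hφ.norm_le a ha) (hf.norm_le a ha) (norm_nonneg _)
      ((norm_nonneg _).trans (hφ.norm_le a ha))
  sub_le a ha b hb := by
    have e : φ a • f a - φ b • f b = φ a • (f a - f b) + (φ a - φ b) • f b := by module
    rw [e]
    refine (norm_add_le _ _).trans ?_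
    rw [norm_smul, norm_smul]
    have h1 := mul_le_mul (hφ.norm_le a ha) (hf.sub_le a ha b hb) (norm_nonneg _)
      ((norm_nonneg _).trans (hφ.norm_le a ha))
    have h2 := mul_le_mul (hφ.sub_le a ha b hb) (hf.norm_le b hb) (norm_nonneg _)
      ((norm_nonneg _).trans (hφ.sub_le a ha b hb))
    linarith

lemma BoundedLipschitzOn.real_inner (hf : BoundedLipschitzOn s f M L)
    (hg : BoundedLipschitzOn s g M' L') :
    BoundedLipschitzOn s (fun a => inner ℝ (f a) (g a)) (M * M') (M * L' + L * M') where
  norm_le a ha := (norm_inner_le_norm _ _).trans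
    (mul_le_mul (hf.norm_le a ha) (hg.norm_le a ha) (norm_nonneg _)
      ((norm_nonneg _).trans (hf.norm_le a ha)))
  sub_le a ha b hb := by
    have e : inner ℝ (f a) (g a) - inner ℝ (f b) (g b)
        = inner ℝ (f a) (g a - g b) + inner ℝ (f a - f b) (g b) := by
      rw [inner_sub_right, inner_sub_left]; ring
    rw [e]
    refine (norm_add_le _ _).trans ?_
    have h1 := (norm_inner_le_norm (𝕜 := ℝ) (f a) (g a - g b)).trans
      (mul_le_mul (hf.norm_le a ha) (hg.sub_le a ha b hb) (norm_nonneg _)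
      ((norm_nonneg _).trans (hf.norm_le a ha)))
    have h2 := (norm_inner_le_norm (𝕜 := ℝ) (f a - f b) (g b)).trans
      (mul_le_mul (hf.sub_le a ha b hb) (hg.norm_le b hb) (norm_nonneg _)
      ((norm_nonneg _).trans (hf.sub_le a ha b hb)))
    linarith

lemma BoundedLipschitzOn.const_smul {c C : ℝ} (hf : BoundedLipschitzOn s f M L) (hc : |c| ≤ C) :
    BoundedLipschitzOn s (fun a => c • f a) (C * M) (C * L) where
  norm_le a ha := by
    rw [norm_smul]
    exact mul_le_mul hc (hf.norm_le a ha) (norm_nonneg _) ((abs_nonneg _).trans hc)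
  sub_le a ha b hb := by
    rw [← smul_sub, norm_smul, mul_assoc]
    exact mul_le_mul hc (hf.sub_le a ha b hb) (norm_nonneg _) ((abs_nonneg _).trans hc)

lemma boundedLipschitzOn_normalize (hr : 0 < r) :
    BoundedLipschitzOn {a : F | r ≤ ‖a‖} (fun a => ‖a‖⁻¹ • a) 1 (2 * r⁻¹) where
  norm_le a ha := by
    have ha0 : 0 < ‖a‖ := hr.trans_le ha
    rw [norm_smul, norm_inv, norm_norm, inv_mul_cancel₀ ha0.ne']
  sub_le a ha b hb := by
    have ha0 : 0 < ‖a‖ := hr.trans_le ha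
    have hb0 : 0 < ‖b‖ := hr.trans_le hb
    have e : ‖a‖⁻¹ • a - ‖b‖⁻¹ • b = ‖a‖⁻¹ • (a - b) + (‖a‖⁻¹ - ‖b‖⁻¹) • b := by module
    have e2 : (‖a‖⁻¹ - ‖b‖⁻¹) * ‖b‖ = ‖a‖⁻¹ * (‖b‖ - ‖a‖) := by field_simp
    rw [e]
    refine (norm_add_le _ _).trans ?_
    rw [norm_smul, norm_smul, ← norm_norm b, ← norm_mul, norm_norm, e2, norm_mul, norm_inv,
      norm_norm]
    have h1 := inv_anti₀ hr ha
    have h3 := abs_norm_sub_norm_le b a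
    rw [norm_sub_rev] at h3
    rw [Real.norm_eq_abs]
    calc _ ≤ r⁻¹ * ‖a - b‖ + r⁻¹ * ‖a - b‖ := by gcongr
      _ = _ := by ring

lemma hasFDerivAt_norm_of_ne_zero {a : F} (ha : a ≠ 0) :
    HasFDerivAt (fun x : F => ‖x‖) (‖a‖⁻¹ • innerSL ℝ a) a := by
  have h0 : ‖a‖ ≠ 0 := norm_ne_zero_iff.2 ha
  have h1 := ((hasStrictFDerivAt_norm_sq a).hasFDerivAt).sqrt (by positivity)
  have e : (fun x : F => Real.sqrt (‖x‖ ^ 2)) = fun x => ‖x‖ := by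
    ext x; exact Real.sqrt_sq (norm_nonneg x)
  rw [e, Real.sqrt_sq (norm_nonneg a)] at h1
  refine h1.congr_fderiv ?_
  ext h
  simp
  field_simp

lemma hasFDerivAt_normalize {a : F} (ha : a ≠ 0) :
    HasFDerivAt (fun x : F => ‖x‖⁻¹ • x) (‖a‖⁻¹ • ContinuousLinearMap.id ℝ F
      - (‖a‖⁻¹ * (‖a‖⁻¹ * ‖a‖⁻¹)) • (innerSL ℝ a).smulRight a) a := by
  have h0 : ‖a‖ ≠ 0 := norm_ne_zero_iff.2 ha
  have h1 := (((hasDerivAt_inv h0).comp_hasFDerivAt a (hasFDerivAt_norm_of_ne_zero ha)).smul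
    (hasFDerivAt_id a))
  refine h1.congr_fderiv ?_
  ext h
  simp [sub_eq_add_neg, smul_smul]
  congr 1
  field_simp

/-- If `S = H(κ a / ‖a‖) - log (t ‖a‖) + ‖a‖² / 2 + const` off the origin, this is `∇S`, where `D`
is the gradient of `H`. -/
noncomputable def radialGradient (κ : ℝ) (D : F → F) (a : F) : F :=
  κ • (‖a‖⁻¹ • (D (κ • ‖a‖⁻¹ • a)
    - inner ℝ (‖a‖⁻¹ • a) (D (κ • ‖a‖⁻¹ • a)) • (‖a‖⁻¹ • a))) - (‖a‖⁻¹ • (‖a‖⁻¹ • a) - a)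

/-- The derivative of `a ↦ a / ‖a‖` is `‖a‖⁻¹` times the projection orthogonal to `a`, so only the
tangential part of `D` survives. -/
lemma hasGradientAt_radial [CompleteSpace F] {H S : F → ℝ} {D : F → F} {κ t C : ℝ} (ht : 0 < t)
    (hH : ∀ θ, HasGradientAt H (D θ) θ)
    (hS : ∀ a, a ≠ 0 → S a = H (κ • ‖a‖⁻¹ • a) + (C - Real.log (t * ‖a‖)) + 2⁻¹ * ‖a‖ ^ 2)
    {a : F} (ha : a ≠ 0) : HasGradientAt S (radialGradient κ D a) a := by
  have h0 : ‖a‖ ≠ 0 := norm_ne_zero_iff.2 ha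
  have hn := hasFDerivAt_norm_of_ne_zero ha
  have h1 := (hH (κ • ‖a‖⁻¹ • a)).hasFDerivAt.comp a ((hasFDerivAt_normalize ha).const_smul κ)
  have h2 := ((hn.const_mul t).log (mul_ne_zero ht.ne' h0)).const_sub C
  have h3 := (hasStrictFDerivAt_norm_sq a).hasFDerivAt.const_mul (2⁻¹ : ℝ)
  rw [hasGradientAt_iff_hasFDerivAt]
  refine (((h1.add h2).add h3).congr_of_eventuallyEq ?_).congr_fderiv ?_
  · filter_upwards [isOpen_ne.mem_nhds ha] with x hx
    exact hS x hx
  · ext h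
    simp [radialGradient, inner_smul_left, real_inner_comm]
    field_simp
    ring

/-- The product rules track the constants: the `H` term gives the part with `B`, and `a / ‖a‖²`
gives `3 r⁻²`. The summand `a` is unbounded, so it is split off and contributes the final `1`. -/
lemma boundedLipschitzOn_radialGradient (hr : 0 < r) {D : F → F} {κ τ B : ℝ} (hκ : |κ| ≤ τ)
    (hB : 0 ≤ B) (hD : ∀ θ, ‖θ‖ ≤ τ → ‖D θ‖ ≤ B)
    (hDL : ∀ θ θ', ‖θ‖ ≤ τ → ‖θ'‖ ≤ τ → ‖D θ' - D θ‖ ≤ B * ‖θ' - θ‖) {a b : F} (ha : r ≤ ‖a‖)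
    (hb : r ≤ ‖b‖) :
    ‖radialGradient κ D a - radialGradient κ D b‖
      ≤ (τ * ((4 * τ * B + 6 * B) * (r⁻¹ * r⁻¹)) + 3 * (r⁻¹ * r⁻¹) + 1) * ‖a - b‖ := by
  have hl := boundedLipschitzOn_inv_norm (F := F) hr
  have hν := boundedLipschitzOn_normalize (F := F) hr
  have hκν := hν.const_smul hκ
  have hDκ : BoundedLipschitzOn {a : F | r ≤ ‖a‖} (fun a => D (κ • ‖a‖⁻¹ • a)) B
      (B * (τ * (2 * r⁻¹))) :=
    { norm_le := fun a ha => hD _ (by simpa using hκν.norm_le a ha)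
      sub_le := fun a ha b hb => by
        refine (hDL _ _ (by simpa using hκν.norm_le b hb) (by simpa using hκν.norm_le a ha)).trans ?_
        rw [mul_assoc]
        exact mul_le_mul_of_nonneg_left (hκν.sub_le a ha b hb) hB }
  have h1 := (hl.smul (hDκ.sub ((hν.real_inner hDκ).smul hν))).const_smul hκ
  have h2 := h1.sub (hl.smul hν)
  have h3 := h2.sub_le a ha b hb
  have e : radialGradient κ D a - radialGradient κ D b
      = ((κ • (‖a‖⁻¹ • (D (κ • ‖a‖⁻¹ • a)
        - inner ℝ (‖a‖⁻¹ • a) (D (κ • ‖a‖⁻¹ • a)) • (‖a‖⁻¹ • a))) - ‖a‖⁻¹ • (‖a‖⁻¹ • a))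
      - (κ • (‖b‖⁻¹ • (D (κ • ‖b‖⁻¹ • b)
        - inner ℝ (‖b‖⁻¹ • b) (D (κ • ‖b‖⁻¹ • b)) • (‖b‖⁻¹ • b))) - ‖b‖⁻¹ • (‖b‖⁻¹ • b)))
      + (a - b) := by
    simp only [radialGradient]; abel
  rw [e]
  refine (norm_add_le _ _).trans ((add_le_add_left h3 _).trans (le_of_eq ?_))
  ring

end BoundedLipschitz

/-! ### The entropy of `⟨Y_t, a⟩` in terms of `negEntropy`. -/

section Smoothed

variable {Ω : Type*} [MeasurableSpace Ω] {P : Measure Ω} {n : ℕ}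
  {X Z : Ω → EuclideanSpace ℝ (Fin n)} {K t m : ℝ}

lemma hasLaw_mul_inner (hZ : HasLaw Z (stdGaussian (EuclideanSpace ℝ (Fin n))) P) (ht : 0 ≤ t)
    (a : EuclideanSpace ℝ (Fin n)) :
    HasLaw (fun ω => t * inner ℝ (Z ω) a) (gaussianReal 0 (Real.toNNReal ((t * ‖a‖) ^ 2))) P := by
  set ℓ : StrongDual ℝ (EuclideanSpace ℝ (Fin n)) := t • innerSL ℝ a with hℓ
  have hn : ‖ℓ‖ = t * ‖a‖ := by
    rw [hℓ, norm_smul, innerSL_apply_norm, Real.norm_of_nonneg ht]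
  have h1 : HasLaw ℓ (gaussianReal 0 (Real.toNNReal ((t * ‖a‖) ^ 2)))
      (stdGaussian (EuclideanSpace ℝ (Fin n))) :=
    { aemeasurable := ℓ.continuous.measurable.aemeasurable
      map_eq := by
        rw [IsGaussian.map_eq_gaussianReal, integral_strongDual_stdGaussian,
          variance_dual_stdGaussian, hn] }
  have h2 := h1.fun_comp hZ
  simpa [hℓ, real_inner_comm] using h2

/-- The cross term vanishes because `G` is centred and independent of `A`. -/
lemma integral_add_gaussian_sq {A G : Ω → ℝ} {v : ℝ≥0} (hA : MemLp A 2 P)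
    (hG : HasLaw G (gaussianReal 0 v) P) (hind : IndepFun A G P) :
    Integrable (fun ω => (A ω + G ω) ^ 2) P ∧
      ∫ ω, (A ω + G ω) ^ 2 ∂P = ∫ ω, A ω ^ 2 ∂P + v := by
  have hG2 : MemLp G 2 P := by
    have h := memLp_id_gaussianReal' (μ := 0) (v := v) 2 (by norm_num)
    rw [← hG.map_eq, memLp_map_measure_iff aestronglyMeasurable_id hG.aemeasurable] at h
    exact h
  have hmean : ∫ ω, G ω ∂P = 0 := by rw [hG.integral_eq, integral_id_gaussianReal]
  have hvar : ∫ ω, G ω ^ 2 ∂P = v := by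
    have := hG.variance_eq
    rwa [variance_id_gaussianReal, variance_of_integral_eq_zero hG.aemeasurable hmean] at this
  have hcross : ∫ ω, A ω * G ω ∂P = 0 := by
    rw [hind.integral_fun_mul_eq_mul_integral hA.1 hG2.1, hmean, mul_zero]
  have iAA := (memLp_two_iff_integrable_sq hA.1).1 hA
  have iGG := (memLp_two_iff_integrable_sq hG2.1).1 hG2
  have iAG : Integrable (fun ω => A ω * G ω) P := hA.integrable_mul hG2
  have e : (fun ω => (A ω + G ω) ^ 2) = fun ω => (A ω ^ 2 + 2 * (A ω * G ω)) + G ω ^ 2 := by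
    ext ω; ring
  have i1 : Integrable (fun ω => A ω ^ 2 + 2 * (A ω * G ω)) P := iAA.add (iAG.const_mul 2)
  rw [e]
  refine ⟨i1.add iGG, ?_⟩
  rw [integral_add i1 iGG, integral_add iAA (iAG.const_mul 2), integral_const_mul, hcross, hvar]
  ring

variable [IsProbabilityMeasure P]

lemma IsSubgaussianVec.sixthMomentLE (h : IsSubgaussianVec P K X) (hK : 0 < K)
    (hX : AEMeasurable X P) : SixthMomentLE P X (12 * K ^ 6) where
  meas u := (hX.inner_const).aestronglyMeasurable
  integrable u hu := ((h u hu).sixth_moment hK hX.inner_const).1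
  le u hu := ((h u hu).sixth_moment hK hX.inner_const).2
  nonneg := by positivity

lemma SixthMomentLE.memLp_two (h : SixthMomentLE P X m) (u : EuclideanSpace ℝ (Fin n)) :
    MemLp (fun ω => inner ℝ (X ω) u) 2 P := by
  rw [memLp_two_iff_integrable_sq (h.meas u)]
  refine ((integrable_const (1:ℝ)).add (h.integrable_and_le u).1).mono' ((h.meas u).pow 2)
    (Filter.Eventually.of_forall fun ω => ?_)
  rw [Real.norm_of_nonneg (sq_nonneg _)]
  simp only [Pi.add_apply]
  generalize (inner ℝ (X ω) u : ℝ) = y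
  have : y ^ 6 = (y ^ 2) ^ 3 := by ring
  rw [this]
  have hy := sq_nonneg y
  rcases le_total (y ^ 2) 1 with h1 | h1
  · have := pow_nonneg hy 3; linarith
  · have := le_self_pow₀ h1 (by norm_num : 3 ≠ 0); linarith

lemma IsIsotropic.integral_inner_sq (hiso : IsIsotropic P X) (h : SixthMomentLE P X m)
    (a : EuclideanSpace ℝ (Fin n)) : ∫ ω, inner ℝ (X ω) a ^ 2 ∂P = ‖a‖ ^ 2 := by
  have hL : ∀ i, MemLp (fun ω => X ω i) 2 P := fun i => by
    simpa [EuclideanSpace.inner_single_right] using h.memLp_two (EuclideanSpace.single i 1)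
  have hint : ∀ i j, Integrable (fun ω => a i * a j * (X ω i * X ω j)) P := fun i j =>
    ((hL i).integrable_mul (hL j)).const_mul _
  have e : ∀ ω, inner ℝ (X ω) a ^ 2 = ∑ i, ∑ j, a i * a j * (X ω i * X ω j) := fun ω => by
    rw [PiLp.inner_apply, pow_two, Finset.sum_mul_sum]
    refine Finset.sum_congr rfl fun i _ => Finset.sum_congr rfl fun j _ => ?_
    simp
    ring
  have hmom : ∀ i j, ∫ ω, X ω i * X ω j ∂P = (1 : Matrix (Fin n) (Fin n) ℝ) i j := fun i j =>
    congr_fun (congr_fun hiso.2 i) j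
  simp_rw [e]
  rw [integral_finsetSum _ fun i _ => integrable_finsetSum _ fun j _ => hint i j]
  simp_rw [integral_finsetSum _ fun j _ => hint _ j, integral_const_mul, hmom, Matrix.one_apply]
  rw [EuclideanSpace.real_norm_sq_eq]
  simp [pow_two]

theorem marginalEntropy_smoothed (hX : AEMeasurable X P) (hiso : IsIsotropic P X)
    (h : SixthMomentLE P X m) (hZ : HasLaw Z (stdGaussian (EuclideanSpace ℝ (Fin n))) P)
    (hind : IndepFun X Z P) (ht : 0 < t) (ht1 : t ≤ 1) {a : EuclideanSpace ℝ (Fin n)}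
    (ha : a ≠ 0) :
    HasPDF (fun ω => inner ℝ (smoothed X Z t ω) a : Ω → ℝ) P volume ∧
    Integrable (relEntropyIntegrand P (fun ω => inner ℝ (smoothed X Z t ω) a)) volume ∧
    marginalEntropy P (smoothed X Z t) a
      = negEntropy P (fun ω => inner ℝ (X ω) ((Real.sqrt (1 - t ^ 2) / t) • ‖a‖⁻¹ • a))
        + (Real.log (Real.sqrt (2 * Real.pi)) - Real.log (t * ‖a‖)) + 2⁻¹ * ‖a‖ ^ 2 := by
  set c := Real.sqrt (1 - t ^ 2) with hc
  have hc2 : c ^ 2 = 1 - t ^ 2 := Real.sq_sqrt (by nlinarith)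
  have hσ : 0 < t * ‖a‖ := mul_pos ht (norm_pos_iff.2 ha)
  have e : (fun ω => inner ℝ (smoothed X Z t ω) a)
      = fun ω => c * inner ℝ (X ω) a + t * inner ℝ (Z ω) a := by
    ext ω
    rw [smoothed, inner_add_left, real_inner_smul_left, real_inner_smul_left]
  have hA : AEMeasurable (fun ω => c * inner ℝ (X ω) a) P := hX.inner_const.const_mul c
  have hG := hasLaw_mul_inner hZ ht.le a
  have hi : IndepFun (fun ω => c * inner ℝ (X ω) a) (fun ω => t * inner ℝ (Z ω) a) P :=
    hind.comp (φ := fun x : EuclideanSpace ℝ (Fin n) => c * inner ℝ x a)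
      (ψ := fun x : EuclideanSpace ℝ (Fin n) => t * inner ℝ x a)
      (by fun_prop) (by fun_prop)
  obtain ⟨hsq, hval⟩ := integral_add_gaussian_sq ((h.memLp_two a).const_mul c) hG hi
  have e2 : (fun ω => c * inner ℝ (X ω) a / (t * ‖a‖))
      = fun ω => inner ℝ (X ω) ((c / t) • ‖a‖⁻¹ • a) := by
    ext ω
    rw [inner_smul_right, inner_smul_right]
    field_simp
  -- Only the shift itself needs an envelope here, so the two auxiliary directions are `0`.
  have henv := h.envelope ((c / t) • ‖a‖⁻¹ • a) 0 0
  rw [← e2] at henv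
  obtain ⟨h1, h2, h3⟩ := relEntropy_add_gaussian hσ hA hG hi henv hsq
  rw [marginalEntropy, e]
  refine ⟨h1, h2, ?_⟩
  rw [h3, hval, e2, Real.coe_toNNReal _ (sq_nonneg _)]
  simp only [mul_pow]
  -- The second moment is `(1 - t²)‖a‖² + t²‖a‖² = ‖a‖²`.
  rw [integral_const_mul, hiso.integral_inner_sq h, hc2]
  ring

end Smoothed

/-- The Lipschitz constant of the entropy gradient, as a polynomial in `K` and `1 / t`. -/
noncomputable def lipschitzPolynomial (r : ℝ) : MvPolynomial (Fin 2) ℝ :=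
  let K := MvPolynomial.X 0
  let τ := MvPolynomial.X 1
  let B := 30720 * (16 * (1 + 12 * K ^ 6 * τ ^ 6 + 12 * K ^ 6 + 12 * K ^ 6)) ^ 2
  τ * ((4 * τ * B + 6 * B) * MvPolynomial.C (r⁻¹ * r⁻¹)) + 3 * MvPolynomial.C (r⁻¹ * r⁻¹) + 1

lemma eval_lipschitzPolynomial (r K τ : ℝ) :
    MvPolynomial.eval ![K, τ] (lipschitzPolynomial r)
      = τ * ((4 * τ * entropyBound (12 * K ^ 6) τ + 6 * entropyBound (12 * K ^ 6) τ)
        * (r⁻¹ * r⁻¹)) + 3 * (r⁻¹ * r⁻¹) + 1 := by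
  simp [lipschitzPolynomial, entropyBound]

theorem mainTheorem5 (r : ℝ) (hr : 0 < r) :
    ∃ p : MvPolynomial (Fin 2) ℝ,
      ∀ (Ω : Type*) [MeasurableSpace Ω] (P : Measure Ω) [IsProbabilityMeasure P]
        (n : ℕ) (X Z : Ω → EuclideanSpace ℝ (Fin n)) (K t : ℝ),
        0 < K → AEMeasurable X P → IsIsotropic P X → IsSubgaussianVec P K X →
        HasLaw Z (stdGaussian (EuclideanSpace ℝ (Fin n))) P → IndepFun X Z P →
        0 < t → t ≤ 1 →
        (∀ a : EuclideanSpace ℝ (Fin n), a ≠ 0 →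
          HasPDF (fun ω => inner ℝ (smoothed X Z t ω) a : Ω → ℝ) P volume ∧
          Integrable (relEntropyIntegrand P (fun ω => inner ℝ (smoothed X Z t ω) a)) volume ∧
          DifferentiableAt ℝ (marginalEntropy P (smoothed X Z t)) a) ∧
        ∃ L : ℝ≥0, (L : ℝ) ≤ MvPolynomial.eval ![K, 1 / t] p ∧
          LipschitzOnWith L (gradient (marginalEntropy P (smoothed X Z t))) {a | r ≤ ‖a‖} := by
  refine ⟨lipschitzPolynomial r, fun Ω _ P _ n X Z K t hK hX hiso hsub hZ hind ht ht1 => ?_⟩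
  have hm := hsub.sixthMomentLE hK hX
  obtain ⟨D, hD, hDB, hDL⟩ := hm.exists_gradient
  have hgrad : ∀ a : EuclideanSpace ℝ (Fin n), a ≠ 0 →
      HasGradientAt (marginalEntropy P (smoothed X Z t))
        (radialGradient (Real.sqrt (1 - t ^ 2) / t) D a) a := fun a ha =>
    hasGradientAt_radial ht hD
      (fun a ha => (marginalEntropy_smoothed hX hiso hm hZ hind ht ht1 ha).2.2) ha
  refine ⟨fun a ha => ?_, ?_⟩
  · obtain ⟨h1, h2, -⟩ := marginalEntropy_smoothed hX hiso hm hZ hind ht ht1 ha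
    exact ⟨h1, h2, (hgrad a ha).differentiableAt⟩
  -- Hence `κ a / ‖a‖` lies in the ball of radius `1 / t` for every `a ≠ 0`, and the bounds on `D`
  -- are used with `R = 1 / t`.
  · have hκ : |Real.sqrt (1 - t ^ 2) / t| ≤ 1 / t := by
      rw [abs_of_nonneg (by positivity)]
      gcongr
      exact Real.sqrt_le_one.2 (by nlinarith [sq_nonneg t])
    have hB : 0 ≤ entropyBound (12 * K ^ 6) (1 / t) := by rw [entropyBound]; positivity
    have hL0 : 0 ≤ MvPolynomial.eval ![K, 1 / t] (lipschitzPolynomial r) := by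
      rw [eval_lipschitzPolynomial]; positivity
    refine ⟨Real.toNNReal _, (Real.coe_toNNReal _ hL0).le,
      LipschitzOnWith.of_dist_le_mul fun a ha b hb => ?_⟩
    have ha0 : a ≠ 0 := norm_pos_iff.1 (hr.trans_le ha)
    have hb0 : b ≠ 0 := norm_pos_iff.1 (hr.trans_le hb)
    rw [(hgrad a ha0).gradient, (hgrad b hb0).gradient, Real.coe_toNNReal _ hL0,
      eval_lipschitzPolynomial, dist_eq_norm, dist_eq_norm]
    exact boundedLipschitzOn_radialGradient hr hκ hB (hDB _) (hDL _) ha hb
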